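/- Let $n\ge 1$, let $l_1,\dots,l_N$ be affine functions on $\mathbb R^n$, and suppose that $P=\bigcap_{i=1}^N\{l_i>0\}\subset\mathbb R^n$ is nonempty and bounded and is a simple convex polytope (every vertex of $\overline P$ lies on exactly $n$ of its $(n-1)$-dimensional faces) whose $(n-1)$-faces are exactly the sets $\overline P\cap\{l_i=0\}$, $i=1,\dots,N$, one for each $i$. Let $\varphi$ be a function on $\overline P$ such that $\varphi-\sum_{i=1}^N l_i\ln l_i\in C^2(\overline P)$ (with $0\ln 0=0$) and such that $\varphi$ is convex on each $(n-1)$-face of $P$. Let $\mathfrak h$ be a measurable function on $P$ with $0<\frac1\Lambda\le\mathfrak h\le\Lambda$ in $P$ for some constant $\Lambda>1$. Then there is exactly one convex function $\mathfrak u\in C(\overline P)$ that solves $$\det D^2\mathfrak u=\frac{\mathfrak h}{\prod_{i=1}^N l_i}\ \text{ in } P,\qquad \mathfrak u=\varphi\ \text{ on }\partial P,$$ where the equation is understood in the sense of Alexandrov: for every Borel set $A\subset P$, $$\Big|\bigcup_{x\in A}\partial\mathfrak u(x)\Big|=\int_A\frac{\mathfrak h}{\prod_{i=1}^N l_i}\,dx,\qquad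 \partial\mathfrak u(x)=\{p\in\mathbb R^n:\ \mathfrak u(y)\ge\mathfrak u(x)+p\cdot(y-x)\ \text{ for all } y\in P\},$$ and $|\cdot|$ denotes Lebesgue measure (both sides may be $+\infty$). -/

import Mathlib

open MeasureTheory
open scoped RealInnerProductSpace ENNReal

/-- The open set `P = ⋂ i, {l i > 0}` cut out by affine functions `l i` on `ℝⁿ`. -/
def polytope {n N : ℕ} (l : Fin N → EuclideanSpace ℝ (Fin n) →ᵃ[ℝ] ℝ) :
    Set (EuclideanSpace ℝ (Fin n)) :=
  {x | ∀ i, 0 < l i x}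

/-- The codimension one face of the polytope carried by the hyperplane `l i = 0`. -/
def polytopeFacet {n N : ℕ} (l : Fin N → EuclideanSpace ℝ (Fin n) →ᵃ[ℝ] ℝ) (i : Fin N) :
    Set (EuclideanSpace ℝ (Fin n)) :=
  {x ∈ closure (polytope l) | l i x = 0}

/-- `P = ⋂ i, {l i > 0}` is a simple convex polytope with nonempty interior, and the `l i` are
exactly its facet-defining functions. -/
structure IsSimplePolytope {n N : ℕ} (l : Fin N → EuclideanSpace ℝ (Fin n) →ᵃ[ℝ] ℝ) : Prop where
  nonempty : (polytope l).Nonempty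
  bounded : Bornology.IsBounded (polytope l)
  /-- The sets `polytopeFacet l i` are genuine (`n-1`)-dimensional faces, one for each index:
  each hyperplane `l i = 0` contains a boundary point of `P` lying on no other hyperplane
  `l j = 0` (so that none of the inequalities is redundant). -/
  facet : ∀ i, ∃ x, l i x = 0 ∧ ∀ j, j ≠ i → 0 < l j x
  /-- Every vertex lies on exactly `n` faces of codimension one. -/
  simple : ∀ v ∈ (closure (polytope l)).extremePoints ℝ, {i | v ∈ polytopeFacet l i}.ncard = n

/-- The subdifferential at `x` of a function `u` on the set `Ω`: the slopes of the affine functions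
that support `u` from below on `Ω` at `x`. -/
def subdifferential {n : ℕ} (Ω : Set (EuclideanSpace ℝ (Fin n)))
    (u : EuclideanSpace ℝ (Fin n) → ℝ) (x : EuclideanSpace ℝ (Fin n)) :
    Set (EuclideanSpace ℝ (Fin n)) :=
  {p | ∀ y ∈ Ω, u x + ⟪p, y - x⟫ ≤ u y}

/-- The Monge-Ampère mass `|∂u(A)|` of a set `A`, i.e. the Lebesgue measure of the union of the
subdifferentials of `u` at the points of `A`. -/
noncomputable def mongeAmpereMass {n : ℕ} (Ω : Set (EuclideanSpace ℝ (Fin n)))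
    (u : EuclideanSpace ℝ (Fin n) → ℝ) (A : Set (EuclideanSpace ℝ (Fin n))) : ℝ≥0∞ :=
  volume (⋃ x ∈ A, subdifferential Ω u x)

/-- `u` solves `det D²u = f` in `Ω` in the sense of Alexandrov: its Monge-Ampère measure
`A ↦ |∂u(A)|` on the Borel subsets of `Ω` is the measure with density `f`. -/
def IsAlexandrovSolution {n : ℕ} (Ω : Set (EuclideanSpace ℝ (Fin n)))
    (u f : EuclideanSpace ℝ (Fin n) → ℝ) : Prop :=
  ConvexOn ℝ Ω u ∧
    ∀ A ⊆ Ω, MeasurableSet A → mongeAmpereMass Ω u A = ∫⁻ x in A, ENNReal.ofReal (f x)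

/-- `u` is (on the closure of `P`) a convex function in `C(P̄)` that solves the Dirichlet problem
`det D²u = h / ∏ i, l i` in `P`, `u = φ` on `∂P`. Values of `u` off the closure play no role. -/
structure SolvesDirichlet {n N : ℕ} (l : Fin N → EuclideanSpace ℝ (Fin n) →ᵃ[ℝ] ℝ)
    (h φ u : EuclideanSpace ℝ (Fin n) → ℝ) : Prop where
  convex : ConvexOn ℝ (closure (polytope l)) u
  continuous : ContinuousOn u (closure (polytope l))
  equation : IsAlexandrovSolution (polytope l) u (fun x => h x / ∏ i, l i x)
  boundary : ∀ x ∈ frontier (polytope l), u x = φ x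

open Set Filter Topology
open scoped Pointwise

/-! ### Convex functions on a bounded convex domain and their boundary behaviour. -/

section ConvexGeometry

variable {E : Type*} [NormedAddCommGroup E] [InnerProductSpace ℝ E]

/-! The solution is obtained by minimising a convex energy. Let `μ` be the measure on `P` with
density `h / ∏ l i`, let `u*` be the conjugate of `u` over the closure of `P`, and `φ*` that of `φ`
over the frontier. For fixed boundary values `φ`, the energy `∫ (u - w) dμ + ∫ (u* - φ*) dp` has
first variation `∫ η dμ - ∫ η (∇u* p) dp` in the direction `η`. The image of Lebesgue measure under
`∇u*` is the Monge–Ampère measure of `u` (`mongeAmpereMass_eq_map`), so a free critical point solves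
the equation.

Minimisation is carried out under an obstacle `u ≥ w`, which forces the boundary values
(`exists_mongeAmpereEnergy_minimizer`). Here `w = φb + 2v`, where `φb` is the supremum of the affine
functions lying below `φ` on the frontier and `v` is a convex subsolution, zero on the frontier and
negative inside. Upward variations are always admissible and give mass at most `μ`. The comparison
principle `le_of_mongeAmpereMass_le`, applied to `v` plus each of these affine functions, then gives
`u ≥ φb + v > w` in `P`. The obstacle is therefore never touched, downward variations become
admissible, and the mass equals `μ` (`exists_mongeAmpereMass_eq`). Uniqueness is the comparison
principle again.

The polytope supplies three ingredients. Convexity of `φ` on the facets makes it a supremum of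
affine functions on the whole frontier (`isAffinelySupported_frontier_polytope`), so `φb = φ` there.
Simplicity gives, near each point, `n` of the `l i` as affine coordinates while the product of the
others stays bounded below (`IsSimplePolytope.exists_uniform_frame`). In these coordinates `v = -C
(∏ l i) ^ (1 / (2N))` has Hessian determinant at least `Λ / ∏ l i` for large `C`
(`IsSimplePolytope.exists_le_mongeAmpereMass`), and its integral against `μ` is finite because `(∏ l
i) ^ (1 / (2N) - 1)` is integrable (`IsSimplePolytope.lintegral_prod_rpow_ne_top`). -/

theorem mem_frontier_of_mem_closure_of_notMem {X : Type*} [TopologicalSpace X] {P : Set X}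
    (hP : IsOpen P) {x : X} (hx : x ∈ closure P) (hxP : x ∉ P) : x ∈ frontier P := by
  rw [hP.frontier_eq]; exact ⟨hx, hxP⟩

/-- A ray starting in a bounded set meets the frontier of this set. -/
theorem exists_ray_mem_frontier {P : Set E} (hb : Bornology.IsBounded P) {x e : E} (hx : x ∈ P)
    (he : e ≠ 0) : ∃ t : ℝ, 0 ≤ t ∧ x + t • e ∈ frontier P := by
  have hpre : IsPreconnected ((fun t : ℝ => x + t • e) '' Ici 0) :=
    isPreconnected_Ici.image _ (by fun_prop)
  obtain ⟨R, hR⟩ := hb.subset_ball x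
  have he' : 0 < ‖e‖ := norm_pos_iff.2 he
  by_contra! hcon
  have hsplit : ∀ y ∈ (fun t : ℝ => x + t • e) '' Ici 0, y ∈ interior P ∨ y ∈ (closure P)ᶜ := by
    rintro _ ⟨t, ht, rfl⟩
    have := hcon t ht
    by_cases h : x + t • e ∈ interior P
    · exact Or.inl h
    · exact Or.inr fun h' => this ⟨h', h⟩
  have hx' : x ∈ (fun t : ℝ => x + t • e) '' Ici 0 := ⟨0, by simp, by simp⟩
  have hfar : x + (max R 0 / ‖e‖) • e ∈ (fun t : ℝ => x + t • e) '' Ici 0 :=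
    ⟨_, div_nonneg (le_max_right _ _) he'.le, rfl⟩
  have hfarP : x + (max R 0 / ‖e‖) • e ∉ P := fun h => by
    have := hR h
    rw [Metric.mem_ball, dist_self_add_left, norm_smul, Real.norm_of_nonneg
      (div_nonneg (le_max_right _ _) he'.le), div_mul_cancel₀ _ he'.ne'] at this
    exact absurd (le_max_left R 0) (not_le.2 this)
  obtain ⟨y, -, hy1, hy2⟩ := hpre _ _ isOpen_interior isClosed_closure.isOpen_compl hsplit
    ⟨x, hx', (hsplit x hx').resolve_right fun h => h (subset_closure hx)⟩
    ⟨_, hfar, (hsplit _ hfar).resolve_left fun h => hfarP (interior_subset h)⟩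
  exact hy2 (subset_closure (interior_subset hy1))

/-- The maximum principle for convex functions. -/
theorem ConvexOn.le_of_forall_frontier_le [Nontrivial E] {P : Set E} (ho : IsOpen P)
    (hb : Bornology.IsBounded P) {u : E → ℝ} (hu : ConvexOn ℝ (closure P) u) {M : ℝ}
    (hM : ∀ y ∈ frontier P, u y ≤ M) : ∀ x ∈ closure P, u x ≤ M := by
  intro x hx
  by_cases hxP : x ∈ P
  · obtain ⟨e, he⟩ := exists_ne (0 : E)
    obtain ⟨t, ht, hy⟩ := exists_ray_mem_frontier hb hxP he
    obtain ⟨s, hs, hz⟩ := exists_ray_mem_frontier hb hxP (neg_ne_zero.2 he)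
    have hseg : x ∈ segment ℝ (x + s • -e) (x + t • e) := by
      rcases (add_nonneg hs ht).eq_or_lt with h0 | h0
      · have h1 : s = 0 := by linarith
        have h2 : t = 0 := by linarith
        simp [h1, h2]
      · refine ⟨t / (s + t), s / (s + t), by positivity, by positivity, ?_, ?_⟩
        · field_simp; ring
        · have h1 : t / (s + t) + s / (s + t) = 1 := by field_simp; ring
          calc (t / (s + t)) • (x + s • -e) + (s / (s + t)) • (x + t • e)
              = (t / (s + t) + s / (s + t)) • x
                + (s / (s + t) * t - t / (s + t) * s) • e := by module
            _ = x := by rw [h1, one_smul]; ring_nf; simp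
    exact (hu.le_max_of_mem_segment (frontier_subset_closure hz) (frontier_subset_closure hy)
      hseg).trans (max_le (hM _ hz) (hM _ hy))
  · exact hM x (mem_frontier_of_mem_closure_of_notMem ho hx hxP)

/-- Convex functions are upper semicontinuous at the boundary, if their boundary values are
dominated by a continuous function. -/
theorem ConvexOn.eventually_lt_of_mem_frontier {P : Set E} (ho : IsOpen P) (hc : Convex ℝ P)
    (hne : P.Nonempty) {u φ : E → ℝ} (hu : ConvexOn ℝ (closure P) u)
    (hφ : ContinuousOn φ (frontier P)) (hle : ∀ y ∈ frontier P, u y ≤ φ y)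
    {x₀ : E} (hx₀ : x₀ ∈ frontier P) {c : ℝ} (hcx : φ x₀ < c) :
    ∀ᶠ x in 𝓝[closure P] x₀, u x < c := by
  obtain ⟨z, hz⟩ := hne
  set s : Set E := (Homeomorph.addLeft z) ⁻¹' P with hs
  have hs0 : s ∈ 𝓝 (0 : E) :=
    (ho.preimage (Homeomorph.addLeft z).continuous).mem_nhds (by simpa [hs] using hz)
  have hsc : Convex ℝ s := by
    have := hc.translate_preimage_right z
    simpa [hs, Homeomorph.addLeft] using this
  have hfr : ∀ x, x ∈ frontier P ↔ x - z ∈ frontier s := fun x => by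
    rw [hs, ← (Homeomorph.addLeft z).preimage_frontier]; simp
  have hcl : ∀ x, x ∈ closure P ↔ x - z ∈ closure s := fun x => by
    rw [hs, ← (Homeomorph.addLeft z).preimage_closure]; simp
  -- The gauge centred at `z` writes `x` as `ρ x • y x + (1 - ρ x) • z`, with `y x` the radial
  -- projection to the frontier; convexity then bounds `u x` by a quantity tending to `φ x₀`.
  set ρ : E → ℝ := fun x => gauge s (x - z) with hρ
  have hρc : Continuous ρ := (continuous_gauge hsc hs0).comp (by fun_prop)
  have hρ1 : ρ x₀ = 1 := (gauge_eq_one_iff_mem_frontier hsc hs0).2 ((hfr x₀).1 hx₀)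
  set y : E → E := fun x => z + (ρ x)⁻¹ • (x - z) with hy
  have hyc : ContinuousAt y x₀ :=
    continuousAt_const.add ((hρc.continuousAt.inv₀ (by simp [hρ1])).smul (by fun_prop))
  have hyx₀ : y x₀ = x₀ := by simp [hy, hρ1]
  have hyf : ∀ x, 0 < ρ x → y x ∈ frontier P := fun x hx => by
    rw [hfr, ← gauge_eq_one_iff_mem_frontier hsc hs0]
    simp only [hy, add_sub_cancel_left]
    rw [gauge_smul_of_nonneg (inv_nonneg.2 hx.le), smul_eq_mul]
    exact inv_mul_cancel₀ hx.ne'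
  have hpos : ∀ᶠ x in 𝓝[closure P] x₀, 0 < ρ x :=
    nhdsWithin_le_nhds (hρc.continuousAt.eventually (lt_mem_nhds (by simp [hρ1])))
  have hφy : Tendsto (fun x => φ (y x)) (𝓝[closure P] x₀) (𝓝 (φ x₀)) := by
    refine (hφ x₀ hx₀).tendsto.comp (tendsto_nhdsWithin_iff.2 ⟨?_, ?_⟩)
    · have := hyc.tendsto; rw [hyx₀] at this
      exact this.mono_left nhdsWithin_le_nhds
    · filter_upwards [hpos] with x hx using hyf x hx
  have hρt : Tendsto ρ (𝓝[closure P] x₀) (𝓝 1) := by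
    rw [← hρ1]; exact hρc.continuousAt.tendsto.mono_left nhdsWithin_le_nhds
  have hlim : Tendsto (fun x => ρ x * φ (y x) + (1 - ρ x) * u z) (𝓝[closure P] x₀)
      (𝓝 (1 * φ x₀ + (1 - 1) * u z)) :=
    (hρt.mul hφy).add ((tendsto_const_nhds.sub hρt).mul tendsto_const_nhds)
  rw [one_mul, sub_self, zero_mul, add_zero] at hlim
  filter_upwards [hpos, hlim.eventually (gt_mem_nhds hcx), self_mem_nhdsWithin] with x hx hlt hxK
  have hρle : ρ x ≤ 1 := (gauge_le_one_iff_mem_closure hsc hs0).2 ((hcl x).1 hxK)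
  have hcomb : ρ x • y x + (1 - ρ x) • z = x := by
    simp only [hy, smul_add, smul_smul, mul_inv_cancel₀ hx.ne']; module
  have := hu.2 (frontier_subset_closure (hyf x hx)) (subset_closure hz) hx.le
    (sub_nonneg.2 hρle) (by ring)
  rw [hcomb] at this
  refine (this.trans ?_).trans_lt hlt
  simp only [smul_eq_mul]
  gcongr
  exact hle _ (hyf x hx)

/-- A convex function that is lower semicontinuous at the boundary, with continuous boundary
values, is continuous up to the boundary. -/
theorem ConvexOn.continuousOn_closure [FiniteDimensional ℝ E] {P : Set E} (ho : IsOpen P)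
    (hc : Convex ℝ P) (hne : P.Nonempty) {u φ : E → ℝ}
    (hu : ConvexOn ℝ (closure P) u) (hφ : ContinuousOn φ (frontier P))
    (heq : ∀ y ∈ frontier P, u y = φ y)
    (hlow : ∀ x ∈ frontier P, ∀ c < φ x, ∀ᶠ y in 𝓝[closure P] x, c < u y) :
    ContinuousOn u (closure P) := by
  intro x hx
  by_cases hxP : x ∈ P
  · have h := (hu.subset subset_closure hc).continuousOn ho
    exact (h.continuousAt (ho.mem_nhds hxP)).continuousWithinAt
  · have hxf := mem_frontier_of_mem_closure_of_notMem ho hx hxP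
    rw [ContinuousWithinAt, heq x hxf, tendsto_order]
    exact ⟨hlow x hxf, fun c hcx => hu.eventually_lt_of_mem_frontier ho hc hne hφ
      (fun y hy => (heq y hy).le) hxf hcx⟩

end ConvexGeometry

/-! ### Legendre conjugates over a compact set and over the whole space. -/

section Conjugate

variable {E : Type*} [NormedAddCommGroup E] [InnerProductSpace ℝ E]

/-- The convex conjugate of the restriction of `f` to `X`. -/
noncomputable def conjOn (X : Set E) (f : E → ℝ) (p : E) : ℝ :=
  sSup ((fun x => ⟪p, x⟫ - f x) '' X)

/-- The convex conjugate of a function on the whole space. -/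
noncomputable def conjUniv (V : E → ℝ) (x : E) : ℝ :=
  ⨆ p, (⟪p, x⟫ - V p)

variable {X : Set E} {f g : E → ℝ}

theorem le_conjOn (hX : IsCompact X) (hf : ContinuousOn f X) {x : E} (hx : x ∈ X) (p : E) :
    ⟪p, x⟫ - f x ≤ conjOn X f p :=
  le_csSup (hX.bddAbove_image (by fun_prop)) ⟨x, hx, rfl⟩

theorem exists_conjOn_eq (hX : IsCompact X) (hne : X.Nonempty) (hf : ContinuousOn f X) (p : E) :
    ∃ x ∈ X, conjOn X f p = ⟪p, x⟫ - f x := by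
  have h : ContinuousOn (fun x => ⟪p, x⟫ - f x) X := by fun_prop
  obtain ⟨x, hx, h⟩ := hX.exists_sSup_image_eq hne h
  exact ⟨x, hx, h⟩

theorem conjOn_le (hne : X.Nonempty) {p : E} {c : ℝ} (h : ∀ x ∈ X, ⟪p, x⟫ - f x ≤ c) :
    conjOn X f p ≤ c :=
  csSup_le (hne.image _) (by rintro _ ⟨x, hx, rfl⟩; exact h x hx)

theorem conjOn_anti (hX : IsCompact X) (hne : X.Nonempty) (hf : ContinuousOn f X)
    (hle : ∀ x ∈ X, f x ≤ g x) (p : E) : conjOn X g p ≤ conjOn X f p :=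
  conjOn_le hne fun x hx => (sub_le_sub_left (hle x hx) _).trans (le_conjOn hX hf hx p)

theorem conjOn_mono_set {Y : Set E} (hY : IsCompact Y) (hne : X.Nonempty) (hg : ContinuousOn g Y)
    (hXY : X ⊆ Y) (hfg : ∀ x ∈ X, g x ≤ f x) (p : E) : conjOn X f p ≤ conjOn Y g p :=
  conjOn_le hne fun x hx => (sub_le_sub_left (hfg x hx) _).trans (le_conjOn hY hg (hXY hx) p)

theorem conjOn_lipschitzWith (hX : IsCompact X) (hne : X.Nonempty) (hf : ContinuousOn f X)
    {R : NNReal} (hR : ∀ x ∈ X, ‖x‖ ≤ R) : LipschitzWith R (conjOn X f) := by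
  refine LipschitzWith.of_le_add_mul R fun p q => ?_
  obtain ⟨x, hx, h⟩ := exists_conjOn_eq hX hne hf p
  have h1 := le_conjOn hX hf hx q
  have h2 : ⟪p - q, x⟫ ≤ R * dist p q := by
    rw [dist_eq_norm, mul_comm]
    exact (real_inner_le_norm _ _).trans (by gcongr; exact hR x hx)
  rw [inner_sub_left] at h2
  linarith

theorem le_conjUniv {V : E → ℝ} {x : E} (hbdd : BddAbove (range fun p => ⟪p, x⟫ - V p)) (p : E) :
    ⟪p, x⟫ - V p ≤ conjUniv V x :=
  le_ciSup hbdd p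

theorem conjUniv_le {V : E → ℝ} {x : E} {c : ℝ} (h : ∀ p, ⟪p, x⟫ - V p ≤ c) : conjUniv V x ≤ c :=
  ciSup_le h

theorem convexOn_conjUniv {V : E → ℝ} {s : Set E} (hs : Convex ℝ s)
    (hbdd : ∀ x ∈ s, BddAbove (range fun p => ⟪p, x⟫ - V p)) : ConvexOn ℝ s (conjUniv V) := by
  refine ⟨hs, fun x hx y hy a b ha hb hab => conjUniv_le fun p => ?_⟩
  have h1 := mul_le_mul_of_nonneg_left (le_conjUniv (hbdd x hx) p) ha
  have h2 := mul_le_mul_of_nonneg_left (le_conjUniv (hbdd y hy) p) hb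
  have h3 : V p = a * V p + b * V p := by rw [← add_mul, hab, one_mul]
  rw [inner_add_right, inner_smul_right, inner_smul_right, smul_eq_mul, smul_eq_mul]
  linarith

/-- Fenchel–Moreau: a continuous convex function on a compact set is its own biconjugate. -/
theorem ConvexOn.le_conjUniv_conjOn [CompleteSpace E] (hX : IsCompact X)
    (hf : ContinuousOn f X) (hc : ConvexOn ℝ X f) {V : E → ℝ} (hV : ∀ p, V p ≤ conjOn X f p)
    {x : E} (hx : x ∈ X) (hbdd : BddAbove (range fun p => ⟪p, x⟫ - V p)) :
    f x ≤ conjUniv V x := by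
  refine le_of_forall_lt fun a ha => ?_
  obtain ⟨b, hab, hb⟩ := exists_between ha
  obtain ⟨L, c, hL, hLx⟩ := ConvexOn.exists_affine_le_of_lt (𝕜 := ℝ) hx hb hX.isClosed
    hf.lowerSemicontinuousOn hc
  obtain ⟨p, rfl⟩ := (InnerProductSpace.toDual ℝ E).surjective L
  have h1 : conjOn X f p ≤ -c := conjOn_le ⟨x, hx⟩ fun y hy => by
    have := hL ⟨y, hy⟩
    simp [InnerProductSpace.toDual_apply_apply] at this
    linarith
  have h2 := le_conjUniv hbdd p
  simp [InnerProductSpace.toDual_apply_apply] at hLx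
  linarith [hV p]

end Conjugate

/-! ### Compactness of Lipschitz families. -/

section Compactness

theorem ENNReal.liminf_add_liminf_le (f g : ℕ → ℝ≥0∞) :
    liminf f atTop + liminf g atTop ≤ liminf (fun k => f k + g k) atTop := by
  simp only [liminf_eq_iSup_iInf_of_nat]
  refine ENNReal.iSup_add_iSup_le fun i j => ?_
  refine le_iSup_of_le (max i j) (le_iInf₂ fun k hk => add_le_add ?_ ?_)
  · exact iInf₂_le k ((le_max_left i j).trans hk)
  · exact iInf₂_le k ((le_max_right i j).trans hk)

/-- A pointwise bounded sequence of uniformly Lipschitz functions on a separable space has a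
pointwise convergent subsequence. -/
theorem LipschitzWith.exists_subseq_tendsto {X : Type*} [PseudoMetricSpace X]
    [TopologicalSpace.SeparableSpace X] {R : NNReal} {V : ℕ → X → ℝ}
    (hV : ∀ k, LipschitzWith R (V k)) {a b : X → ℝ} (ha : ∀ k p, a p ≤ V k p)
    (hb : ∀ k p, V k p ≤ b p) :
    ∃ (θ : ℕ → ℕ) (W : X → ℝ), StrictMono θ ∧ LipschitzWith R W ∧
      ∀ p, Tendsto (fun k => V (θ k) p) atTop (𝓝 (W p)) := by
  rcases isEmpty_or_nonempty X with hX | hX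
  · exact ⟨id, fun _ => 0, strictMono_id, LipschitzWith.const' _ , fun p => (hX.false p).elim⟩
  set D := TopologicalSpace.denseSeq X
  -- A countable product of intervals is sequentially compact, which takes the place of a diagonal
  -- argument over the dense sequence.
  have hS : IsCompact (univ.pi fun i => Icc (a (D i)) (b (D i))) :=
    isCompact_univ_pi fun i => isCompact_Icc
  obtain ⟨W₀, -, θ, hθ, hlim⟩ := hS.tendsto_subseq (x := fun k i => V k (D i))
    fun k i _ => ⟨ha k _, hb k _⟩
  rw [tendsto_pi_nhds] at hlim
  have hcau : ∀ p, CauchySeq fun k => V (θ k) p := fun p => by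
    rw [Metric.cauchySeq_iff]
    intro ε hε
    obtain ⟨i, hi⟩ := (TopologicalSpace.denseRange_denseSeq X).exists_dist_lt p
      (show 0 < ε / (3 * (R + 1)) by positivity)
    have h1 : R * dist p (D i) < ε / 3 := by
      calc R * dist p (D i) ≤ (R + 1) * dist p (D i) := by gcongr; linarith
        _ < (R + 1) * (ε / (3 * (R + 1))) := by gcongr
        _ = ε / 3 := by field_simp
    obtain ⟨M, hM⟩ := Metric.cauchySeq_iff.1 (hlim i).cauchySeq (ε / 3) (by positivity)
    refine ⟨M, fun j hj k hk => ?_⟩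
    have h2 := hM j hj k hk
    have h3 := (hV (θ j)).dist_le_mul p (D i)
    have h4 := (hV (θ k)).dist_le_mul p (D i)
    have h5 := dist_triangle4 (V (θ j) p) (V (θ j) (D i)) (V (θ k) (D i)) (V (θ k) p)
    simp only [Function.comp_apply] at h2
    rw [dist_comm (V (θ k) (D i))] at h5
    linarith
  choose W hW using fun p => cauchySeq_tendsto_of_complete (hcau p)
  refine ⟨θ, W, hθ, LipschitzWith.of_dist_le_mul fun p q => ?_, hW⟩
  exact le_of_tendsto ((hW p).dist (hW q))
    (Eventually.of_forall fun k => (hV (θ k)).dist_le_mul p q)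

end Compactness

/-! ### The largest convex extension of the boundary data. -/

section BoundaryData

variable {E : Type*} [NormedAddCommGroup E] [InnerProductSpace ℝ E]
  {P : Set E} {φ : E → ℝ}

/-- `φ` is, on the set `X`, the supremum of affine functions. -/
def IsAffinelySupported (X : Set E) (φ : E → ℝ) : Prop :=
  ∀ x ∈ X, ∀ c < φ x, ∃ (p : E) (b : ℝ), (∀ y ∈ X, ⟪p, y⟫ + b ≤ φ y) ∧ c ≤ ⟪p, x⟫ + b

theorem isCompact_frontier_of_isBounded [FiniteDimensional ℝ E] (hb : Bornology.IsBounded P) :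
    IsCompact (frontier P) :=
  Metric.isCompact_of_isClosed_isBounded isClosed_frontier
    (hb.closure.subset frontier_subset_closure)

theorem frontier_nonempty_of_isBounded [Nontrivial E] (hb : Bornology.IsBounded P)
    (hne : P.Nonempty) : (frontier P).Nonempty := by
  obtain ⟨e, he⟩ := exists_ne (0 : E)
  obtain ⟨t, -, h⟩ := exists_ray_mem_frontier hb hne.some_mem he
  exact ⟨_, h⟩

variable [FiniteDimensional ℝ E] [Nontrivial E]

/-- On the frontier `⟪p, ·⟫ - V p ≤ φ`, hence it is at most `max φ`, and the maximum principle
carries this bound inside. Without it the real supremum in `conjUniv` would take its default value.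
-/
theorem bddAbove_range_of_conjOn_le (ho : IsOpen P) (hc : Convex ℝ P)
    (hb : Bornology.IsBounded P) (hφ : ContinuousOn φ (frontier P)) {V : E → ℝ}
    (hV : ∀ p, conjOn (frontier P) φ p ≤ V p) {x : E} (hx : x ∈ closure P) :
    BddAbove (range fun p => ⟪p, x⟫ - V p) := by
  have hcF := isCompact_frontier_of_isBounded hb
  obtain ⟨M, hM⟩ := hcF.bddAbove_image hφ
  refine ⟨M, ?_⟩
  rintro _ ⟨p, rfl⟩
  have hlin : ConvexOn ℝ (closure P) fun x => ⟪p, x⟫ :=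
    (innerₗ E p).convexOn hc.closure
  have := hlin.le_of_forall_frontier_le ho hb (M := V p + M) (fun y hy => by
    have h1 := le_conjOn hcF hφ hy p
    have h2 := hM ⟨y, hy, rfl⟩
    have := hV p
    linarith) x hx
  exact sub_le_iff_le_add'.2 this

omit [Nontrivial E] in
theorem conjUniv_conjOn_le (hb : Bornology.IsBounded P)
    (hφ : ContinuousOn φ (frontier P)) {V : E → ℝ}
    (hV : ∀ p, conjOn (frontier P) φ p ≤ V p) {x : E} (hx : x ∈ frontier P) :
    conjUniv V x ≤ φ x :=
  conjUniv_le fun p => by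
    have := le_conjOn (isCompact_frontier_of_isBounded hb) hφ hx p
    have := hV p
    linarith

/-- An affine function below `φ` on the frontier and nearly touching at `x` has slope `p` and
constant term at most `-φ*(p)`, so it is dominated by a competitor in the biconjugate. -/
theorem conjUniv_conjOn_frontier (ho : IsOpen P) (hc : Convex ℝ P)
    (hb : Bornology.IsBounded P) (hφ : ContinuousOn φ (frontier P))
    (hs : IsAffinelySupported (frontier P) φ) {x : E} (hx : x ∈ frontier P) :
    conjUniv (conjOn (frontier P) φ) x = φ x := by
  refine le_antisymm (conjUniv_conjOn_le hb hφ (fun _ => le_rfl) hx)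
    (le_of_forall_lt fun c hcx => ?_)
  obtain ⟨d, hcd, hd⟩ := exists_between hcx
  obtain ⟨p, b, h1, h2⟩ := hs x hx d hd
  have h3 : conjOn (frontier P) φ p ≤ -b := conjOn_le ⟨x, hx⟩ fun y hy => by
    linarith [h1 y hy]
  have h4 := le_conjUniv (bddAbove_range_of_conjOn_le ho hc hb hφ (fun _ => le_rfl)
    (frontier_subset_closure hx)) p
  linarith

theorem continuousOn_conjUniv_conjOn (ho : IsOpen P) (hc : Convex ℝ P)
    (hb : Bornology.IsBounded P) (hne : P.Nonempty) (hφ : ContinuousOn φ (frontier P))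
    (hs : IsAffinelySupported (frontier P) φ) :
    ContinuousOn (conjUniv (conjOn (frontier P) φ)) (closure P) := by
  have hbd := fun x (hx : x ∈ closure P) =>
    bddAbove_range_of_conjOn_le ho hc hb hφ (fun _ => le_rfl) hx
  refine (convexOn_conjUniv hc.closure hbd).continuousOn_closure ho hc hne hφ
    (fun y hy => conjUniv_conjOn_frontier ho hc hb hφ hs hy) fun x hx c hcx => ?_
  rw [← conjUniv_conjOn_frontier ho hc hb hφ hs hx] at hcx
  obtain ⟨p, hp⟩ := exists_lt_of_lt_ciSup hcx
  have : ContinuousWithinAt (fun y => ⟪p, y⟫ - conjOn (frontier P) φ p) (closure P) x := by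
    fun_prop
  filter_upwards [this.tendsto.eventually (lt_mem_nhds hp), self_mem_nhdsWithin] with y hy hyK
  exact hy.trans_le (le_conjUniv (hbd y hyK) p)

end BoundaryData

/-! ### Existence of a minimiser by the direct method. -/

section Minimizer

variable {E : Type*} [NormedAddCommGroup E] [InnerProductSpace ℝ E]
  [MeasurableSpace E] {P : Set E}

/-- The convex functional whose Euler–Lagrange equation is the Monge–Ampère equation with right
hand side `μ`. -/
noncomputable def mongeAmpereEnergy (μ ν : Measure E) (P : Set E) (φ w u V : E → ℝ) : ℝ≥0∞ :=
  ∫⁻ x in P, ENNReal.ofReal (u x - w x) ∂μ +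
    ∫⁻ p, ENNReal.ofReal (V p - conjOn (frontier P) φ p) ∂ν

variable [FiniteDimensional ℝ E] [Nontrivial E] [BorelSpace E]

/-- The unknown is taken to be the conjugate `V` rather than `u`: admissible `V` are uniformly
Lipschitz and pinched between two fixed functions, hence compact for pointwise convergence, and
Fatou makes both terms of the energy lower semicontinuous. Replacing a pair by a conjugate pair only
lowers the energy, so minimising over `V` also minimises over all `g`. -/
theorem exists_mongeAmpereEnergy_minimizer (μ ν : Measure E) (ho : IsOpen P) (hc : Convex ℝ P)
    (hb : Bornology.IsBounded P) (hne : P.Nonempty) {φ w : E → ℝ}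
    (hφ : ContinuousOn φ (frontier P)) (hw : ContinuousOn w (closure P))
    (hwc : ConvexOn ℝ (closure P) w) (hwφ : ∀ x ∈ frontier P, w x = φ x)
    (hfin : ∫⁻ x in P, ENNReal.ofReal (conjUniv (conjOn (frontier P) φ) x - w x) ∂μ ≠ ∞) :
    ∃ u : E → ℝ, ConvexOn ℝ (closure P) u ∧ ContinuousOn u (closure P) ∧
      (∀ x ∈ closure P, w x ≤ u x) ∧ (∀ x ∈ frontier P, u x = φ x) ∧
      mongeAmpereEnergy μ ν P φ w u (conjOn (closure P) u) ≠ ∞ ∧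
      ∀ g : E → ℝ, ContinuousOn g (closure P) → (∀ x ∈ closure P, w x ≤ g x) →
        (∀ x ∈ frontier P, g x = φ x) →
        mongeAmpereEnergy μ ν P φ w u (conjOn (closure P) u) ≤
          mongeAmpereEnergy μ ν P φ w g (conjOn (closure P) g) := by
  set φs := conjOn (frontier P) φ with hφs
  have hcK : IsCompact (closure P) := hb.isCompact_closure
  have hcF := isCompact_frontier_of_isBounded hb
  have hneK : (closure P).Nonempty := hne.closure
  have hneF := frontier_nonempty_of_isBounded hb hne
  obtain ⟨R, hR⟩ : ∃ R : NNReal, ∀ x ∈ closure P, ‖x‖ ≤ R := by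
    obtain ⟨C, hC⟩ := hcK.isBounded.exists_norm_le
    exact ⟨C.toNNReal, fun x hx => (hC x hx).trans (Real.le_coe_toNNReal C)⟩
  have hφsL : LipschitzWith R φs :=
    conjOn_lipschitzWith hcF hneF hφ fun x hx => hR x (frontier_subset_closure hx)
  let D : Set (E → ℝ) :=
    {V | LipschitzWith R V ∧ (∀ p, φs p ≤ V p) ∧ ∀ p, V p ≤ conjOn (closure P) w p}
  have hbd : ∀ V ∈ D, ∀ x ∈ closure P, BddAbove (range fun p => ⟪p, x⟫ - V p) :=
    fun V hV x hx => bddAbove_range_of_conjOn_le ho hc hb hφ hV.2.1 hx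
  have hcv : ∀ V ∈ D, ConvexOn ℝ (closure P) (conjUniv V) :=
    fun V hV => convexOn_conjUniv hc.closure (hbd V hV)
  have hwm : AEMeasurable w (μ.restrict P) :=
    (hw.mono subset_closure).aemeasurable ho.measurableSet
  have hmeas : ∀ V ∈ D, AEMeasurable (fun x => ENNReal.ofReal (conjUniv V x - w x))
      (μ.restrict P) := fun V hV =>
    (((((hcv V hV).subset subset_closure hc).continuousOn ho).aemeasurable
      ho.measurableSet).sub hwm).ennreal_ofReal
  let F : (E → ℝ) → ℝ≥0∞ := fun V => mongeAmpereEnergy μ ν P φ w (conjUniv V) V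
  have hgD : ∀ g : E → ℝ, ContinuousOn g (closure P) → (∀ x ∈ closure P, w x ≤ g x) →
      (∀ x ∈ frontier P, g x ≤ φ x) → conjOn (closure P) g ∈ D := fun g hg h1 h2 =>
    ⟨conjOn_lipschitzWith hcK hneK hg hR,
      conjOn_mono_set hcK hneF hg frontier_subset_closure h2, conjOn_anti hcK hneK hw h1⟩
  have hφD : φs ∈ D := ⟨hφsL, fun _ => le_rfl,
    conjOn_mono_set hcK hneF hw frontier_subset_closure fun x hx => (hwφ x hx).le⟩
  -- At `V = φs` the second term vanishes, so the infimum is finite.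
  have hFφ : F φs ≠ ∞ := by simpa [F, mongeAmpereEnergy, hφs] using hfin
  obtain ⟨m, -, hm, hmF⟩ := exists_seq_tendsto_sInf (S := F '' D) ⟨_, φs, hφD, rfl⟩
    (OrderBot.bddBelow _)
  choose V hVD hVm using hmF
  obtain ⟨θ, W, hθ, hWL, hW⟩ := LipschitzWith.exists_subseq_tendsto (fun k => (hVD k).1)
    (fun k => (hVD k).2.1) (fun k => (hVD k).2.2)
  have hWD : W ∈ D := ⟨hWL, fun p => ge_of_tendsto' (hW p) fun k => (hVD _).2.1 p,
    fun p => le_of_tendsto' (hW p) fun k => (hVD _).2.2 p⟩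
  have hA : ∫⁻ x in P, ENNReal.ofReal (conjUniv W x - w x) ∂μ ≤
      liminf (fun k => ∫⁻ x in P, ENNReal.ofReal (conjUniv (V (θ k)) x - w x) ∂μ) atTop := by
    refine le_trans (setLIntegral_mono' ho.measurableSet fun x hx => ?_)
      (lintegral_liminf_le' fun k => hmeas _ (hVD (θ k)))
    refine le_of_forall_lt fun c hcx => ?_
    obtain ⟨d, hcd, hd⟩ := exists_between hcx
    refine hcd.trans_le ?_
    have hdt : d ≠ ∞ := hd.ne_top
    rw [ENNReal.lt_ofReal_iff_toReal_lt hdt, lt_sub_iff_add_lt] at hd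
    -- A single slope `p` nearly attaining the supremum for `W` bounds all late terms of the
    -- sequence from below.
    obtain ⟨p, hp⟩ := exists_lt_of_lt_ciSup hd
    refine le_liminf_of_le (by isBoundedDefault) ?_
    have : Tendsto (fun k => ⟪p, x⟫ - V (θ k) p) atTop (𝓝 (⟪p, x⟫ - W p)) :=
      tendsto_const_nhds.sub (hW p)
    filter_upwards [this.eventually (lt_mem_nhds hp)] with k hk
    have h3 := le_conjUniv (hbd _ (hVD (θ k)) x (subset_closure hx)) p
    rw [← ENNReal.ofReal_toReal hdt]
    exact ENNReal.ofReal_le_ofReal (by linarith)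
  have hB : ∫⁻ p, ENNReal.ofReal (W p - φs p) ∂ν ≤
      liminf (fun k => ∫⁻ p, ENNReal.ofReal (V (θ k) p - φs p) ∂ν) atTop := by
    refine le_trans (lintegral_mono fun p => ?_) (lintegral_liminf_le fun k =>
      (((hVD (θ k)).1.continuous.sub hφsL.continuous).measurable).ennreal_ofReal)
    exact (((ENNReal.continuous_ofReal.tendsto _).comp
      ((hW p).sub tendsto_const_nhds)).liminf_eq).ge
  have hWmin : ∀ V' ∈ D, F W ≤ F V' := by
    have h1 : F W ≤ sInf (F '' D) := by
      refine (add_le_add hA hB).trans ?_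
      have h2 : Tendsto (fun k => F (V (θ k))) atTop (𝓝 (sInf (F '' D))) := by
        have := hm.comp hθ.tendsto_atTop
        refine this.congr fun k => (hVm (θ k)).symm
      rw [← h2.liminf_eq]
      exact ENNReal.liminf_add_liminf_le _ _
    exact fun V' hV' => h1.trans (sInf_le ⟨V', hV', rfl⟩)
  set u := conjUniv W with hu
  -- The upper bound `V ≤ w*` in `D` encodes the obstacle: conjugating back gives `u ≥ w** = w`.
  have huw : ∀ x ∈ closure P, w x ≤ u x := fun x hx =>
    hwc.le_conjUniv_conjOn hcK hw hWD.2.2 hx (hbd W hWD x hx)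
  have huφ : ∀ x ∈ frontier P, u x = φ x := fun x hx =>
    le_antisymm (conjUniv_conjOn_le hb hφ hWD.2.1 hx)
      (hwφ x hx ▸ huw x (frontier_subset_closure hx))
  have huc : ContinuousOn u (closure P) := by
    refine (hcv W hWD).continuousOn_closure ho hc hne hφ huφ fun x hx c hcx => ?_
    rw [← hwφ x hx] at hcx
    filter_upwards [(hw x (frontier_subset_closure hx)).tendsto.eventually (lt_mem_nhds hcx),
      self_mem_nhdsWithin] with y hy hyK using hy.trans_le (huw y hyK)
  have hEle : mongeAmpereEnergy μ ν P φ w u (conjOn (closure P) u) ≤ F W := by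
    refine add_le_add le_rfl (lintegral_mono fun p => ENNReal.ofReal_le_ofReal
      (sub_le_sub_right (conjOn_le hneK fun x hx => ?_) _))
    have := le_conjUniv (hbd W hWD x hx) p
    linarith
  refine ⟨u, hcv W hWD, huc, huw, huφ, (hEle.trans_lt ((hWmin _ hφD).trans_lt
    hFφ.lt_top)).ne, fun g hg hwg hgφ => ?_⟩
  have hgD' := hgD g hg hwg fun x hx => (hgφ x hx).le
  refine hEle.trans ((hWmin _ hgD').trans (add_le_add
    (setLIntegral_mono' ho.measurableSet fun x hx => ENNReal.ofReal_le_ofReal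
      (sub_le_sub_right (conjUniv_le fun p => ?_) _)) le_rfl))
  have := le_conjOn hcK hg (subset_closure hx) p
  linarith

end Minimizer

/-! ### Differentiating the conjugate in the slope and in the function. -/

section ConjugateDerivative

variable {E : Type*} [NormedAddCommGroup E] [InnerProductSpace ℝ E] [CompleteSpace E]
  {K S : Set E} {u η : E → ℝ}

/-- At a point of differentiability of the conjugate, the maximiser is unique and equal to the
gradient of the conjugate. -/
theorem eq_gradient_conjOn (hK : IsCompact K) (hu : ContinuousOn u K) {p x : E}
    (hd : DifferentiableAt ℝ (conjOn K u) p) (hx : x ∈ K) (h : conjOn K u p = ⟪p, x⟫ - u x) :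
    gradient (conjOn K u) p = x := by
  -- The maximiser `x` at `p` remains a competitor at every other slope `q`.
  have hmin : IsLocalMin (fun q => conjOn K u q - ⟪x, q⟫) p := by
    refine Eventually.of_forall fun q => ?_
    have h1 := le_conjOn hK hu hx q
    have h2 := real_inner_comm x q
    have h3 := real_inner_comm x p
    simp only
    linarith
  have h2 : HasFDerivAt (fun q => conjOn K u q - ⟪x, q⟫)
      (fderiv ℝ (conjOn K u) p - innerSL ℝ x) p :=
    hd.hasFDerivAt.sub (innerSL ℝ x).hasFDerivAt
  have h3 := sub_eq_zero.1 (hmin.hasFDerivAt_eq_zero h2)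
  rw [gradient, h3]
  exact (InnerProductSpace.toDual ℝ E).symm_apply_apply x

theorem gradient_conjOn_mem (hK : IsCompact K) (hne : K.Nonempty) (hu : ContinuousOn u K) {p : E}
    (hd : DifferentiableAt ℝ (conjOn K u) p) :
    gradient (conjOn K u) p ∈ K ∧
      conjOn K u p = ⟪p, gradient (conjOn K u) p⟫ - u (gradient (conjOn K u) p) := by
  obtain ⟨x, hx, h⟩ := exists_conjOn_eq hK hne hu p
  rw [eq_gradient_conjOn hK hu hd hx h]
  exact ⟨hx, h⟩

/-- The first variation of the conjugate. -/
theorem tendsto_conjOn_variation (hK : IsCompact K) (hne : K.Nonempty) (hu : ContinuousOn u K)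
    (hη : Continuous η) {p : E} (hd : DifferentiableAt ℝ (conjOn K u) p) :
    Tendsto (fun t : ℝ => (conjOn K (fun x => u x + t * η x) p - conjOn K u p) / t) (𝓝[>] 0)
      (𝓝 (-η (gradient (conjOn K u) p))) := by
  obtain ⟨hT, hTu⟩ := gradient_conjOn_mem hK hne hu hd
  set x₀ := gradient (conjOn K u) p with hx₀
  have hut : ∀ t : ℝ, ContinuousOn (fun x => u x + t * η x) K := fun t => by fun_prop
  rw [tendsto_order]
  constructor
  · intro c hc
    filter_upwards [self_mem_nhdsWithin] with t ht
    have h1 := le_conjOn hK (hut t) hT p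
    refine hc.trans_le ?_
    rw [le_div_iff₀ ht]
    linarith
  · intro c hc
    obtain ⟨M, hM⟩ := (hK.image hη).isBounded.exists_norm_le
    have hM' : ∀ x ∈ K, |η x| ≤ M := fun x hx => hM _ ⟨x, hx, rfl⟩
    -- The unique maximiser at `p` lies outside the compact set `S`, so on `S` the maximum is missed
    -- by a gap `γ`. For small `t` the maximisers of the perturbed problem therefore avoid `S`.
    set S : Set E := K ∩ {y | η y ≤ -c} with hS
    have hSc : IsCompact S := hK.inter_right (isClosed_le hη continuous_const)
    have key : ∃ γ > 0, ∀ y ∈ S, ⟪p, y⟫ - u y ≤ conjOn K u p - γ := by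
      rcases S.eq_empty_or_nonempty with he | hSne
      · exact ⟨1, one_pos, fun y hy => by simp [he] at hy⟩
      · obtain ⟨y₀, hy₀, hmax⟩ := hSc.exists_isMaxOn hSne
          (f := fun y => ⟪p, y⟫ - u y) (by
            have := hu.mono (inter_subset_left : S ⊆ K)
            fun_prop)
        have hle := le_conjOn hK hu hy₀.1 p
        have hlt : ⟪p, y₀⟫ - u y₀ < conjOn K u p := by
          refine lt_of_le_of_ne hle fun h => ?_
          have h1 := eq_gradient_conjOn hK hu hd hy₀.1 h.symm
          have h2 : η y₀ ≤ -c := hy₀.2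
          rw [← h1, ← hx₀] at h2
          linarith
        exact ⟨_, sub_pos.2 hlt, fun y hy => by
          have : ⟪p, y⟫ - u y ≤ ⟪p, y₀⟫ - u y₀ := hmax hy
          linarith⟩
    obtain ⟨γ, hγ, hγS⟩ := key
    have hsmall : ∀ᶠ t : ℝ in 𝓝[>] 0, t * (2 * M) < γ := by
      have : Tendsto (fun t : ℝ => t * (2 * M)) (𝓝[>] 0) (𝓝 (0 * (2 * M))) :=
        ((continuous_id.mul continuous_const).tendsto 0).mono_left nhdsWithin_le_nhds
      rw [zero_mul] at this
      exact this.eventually (gt_mem_nhds hγ)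
    filter_upwards [self_mem_nhdsWithin, hsmall] with t (ht : 0 < t) hts
    obtain ⟨x, hx, hxt⟩ := exists_conjOn_eq hK hne (hut t) p
    have h1 := le_conjOn hK (hut t) hT p
    have h2 := le_conjOn hK hu hx p
    have hxS : x ∉ S := fun h => by
      have h3 := hγS x h
      have h4 := abs_le.1 (hM' x hx)
      have h5 := abs_le.1 (hM' _ hT)
      have h6 : t * η x₀ ≤ t * M := by gcongr; exact h5.2
      have h7 : t * -M ≤ t * η x := by gcongr; exact h4.1
      linarith
    have hηx : -c < η x := by
      by_contra! h
      exact hxS ⟨hx, h⟩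
    rw [hxt, div_lt_iff₀ ht]
    have : t * -c < t * η x := by gcongr
    linarith

omit [CompleteSpace E] in
theorem abs_conjOn_variation_le (hK : IsCompact K) (hne : K.Nonempty) (hu : ContinuousOn u K)
    (hη : Continuous η) {M : ℝ} (hM : ∀ x ∈ K, |η x| ≤ M) {t : ℝ} (ht : 0 ≤ t) (p : E) :
    |conjOn K (fun x => u x + t * η x) p - conjOn K u p| ≤ t * M := by
  have hut : ContinuousOn (fun x => u x + t * η x) K := by fun_prop
  rw [abs_sub_le_iff]
  constructor
  · obtain ⟨x, hx, hxt⟩ := exists_conjOn_eq hK hne hut p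
    have h2 := le_conjOn hK hu hx p
    have h3 : t * -M ≤ t * η x := by gcongr; exact (abs_le.1 (hM x hx)).1
    linarith
  · obtain ⟨x, hx, hxt⟩ := exists_conjOn_eq hK hne hu p
    have h2 := le_conjOn hK hut hx p
    have h3 : t * η x ≤ t * M := by gcongr; exact (abs_le.1 (hM x hx)).2
    linarith

omit [CompleteSpace E] in
/-- Slopes at interior points are bounded. -/
theorem norm_mul_le_of_conjOn_eq (hK : IsCompact K) (hu : ContinuousOn u K) {B r : ℝ}
    (hr : 0 ≤ r) (hB : ∀ x ∈ K, |u x| ≤ B) {p x : E} (hx : x ∈ K)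
    (hball : Metric.closedBall x r ⊆ K)
    (h : conjOn K u p = ⟪p, x⟫ - u x) : r * ‖p‖ ≤ 2 * B := by
  rcases eq_or_ne p 0 with rfl | hp
  · have := (abs_nonneg _).trans (hB x hx)
    simpa using this
  have hp' : 0 < ‖p‖ := norm_pos_iff.2 hp
  -- Moving a distance `r` in the direction of `p` raises `⟪p, ·⟫` by `r * ‖p‖`, which the
  -- oscillation of `u` must compensate.
  have hy : x + (r / ‖p‖) • p ∈ K := hball (by
    rw [Metric.mem_closedBall, dist_self_add_left, norm_smul, Real.norm_of_nonneg (by positivity),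
      div_mul_cancel₀ _ hp'.ne'])
  have h1 := le_conjOn hK hu hy p
  have h2 := (abs_le.1 (hB _ hy)).2
  have h3 := (abs_le.1 (hB x hx)).1
  have h4 : ⟪p, x + (r / ‖p‖) • p⟫ = ⟪p, x⟫ + r * ‖p‖ := by
    rw [inner_add_right, inner_smul_right, real_inner_self_eq_norm_sq]
    field_simp
  linarith

omit [InnerProductSpace ℝ E] [CompleteSpace E] in
theorem exists_closedBall_subset_closure {P : Set E} (ho : IsOpen P) (hS : IsCompact S)
    (hSP : S ⊆ P) : ∃ r > 0, ∀ x ∈ S, Metric.closedBall x r ⊆ closure P := by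
  obtain ⟨r, hr, h⟩ := hS.exists_cthickening_subset_open ho hSP
  exact ⟨r, hr, fun x hx => (Metric.closedBall_subset_cthickening hx r).trans
    (h.trans subset_closure)⟩

-- A slope attained at a point of `S` is bounded, uniformly in `t ≤ 1`, since `S` keeps a positive
-- distance from the boundary; for steeper slopes the maximisers never see `η`. Integrals of the
-- variation thus run over a fixed ball.
omit [CompleteSpace E] in
theorem exists_conjOn_variation_eq_zero {P : Set E} (ho : IsOpen P) (hK : IsCompact (closure P))
    (hne : P.Nonempty)
    (hu : ContinuousOn u (closure P)) (hη : Continuous η) (hS : IsCompact S) (hSP : S ⊆ P)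
    (hηS : ∀ x, x ∉ S → η x = 0) :
    ∃ R : ℝ, ∀ t ∈ Ioc (0 : ℝ) 1, ∀ p : E, R < ‖p‖ →
      conjOn (closure P) (fun x => u x + t * η x) p = conjOn (closure P) u p := by
  obtain ⟨r, hr, hball⟩ := exists_closedBall_subset_closure ho hS hSP
  obtain ⟨M, hM⟩ := (hK.image hη).isBounded.exists_norm_le
  obtain ⟨C, hC⟩ := (hK.image_of_continuousOn hu).isBounded.exists_norm_le
  have hM' : ∀ x ∈ closure P, |η x| ≤ M := fun x hx => hM _ ⟨x, hx, rfl⟩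
  have hC' : ∀ x ∈ closure P, |u x| ≤ C := fun x hx => hC _ ⟨x, hx, rfl⟩
  have hM0 : 0 ≤ M := (abs_nonneg _).trans (hM' _ (subset_closure hne.some_mem))
  refine ⟨2 * (C + M) / r, fun t ht p hp => ?_⟩
  rw [div_lt_iff₀ hr] at hp
  have hut : ContinuousOn (fun x => u x + t * η x) (closure P) := by fun_prop
  have hutB : ∀ x ∈ closure P, |u x + t * η x| ≤ C + M := fun x hx => by
    refine (abs_add_le _ _).trans (add_le_add (hC' x hx) ?_)
    rw [abs_mul, abs_of_pos ht.1]
    exact (mul_le_of_le_one_left (abs_nonneg _) ht.2).trans (hM' x hx)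
  apply le_antisymm
  · obtain ⟨x, hx, hxt⟩ := exists_conjOn_eq hK hne.closure hut p
    by_cases hxS : x ∈ S
    · have := norm_mul_le_of_conjOn_eq hK hut hr.le hutB hx (hball x hxS) hxt
      linarith
    · rw [hxt, hηS x hxS, mul_zero, add_zero]
      exact le_conjOn hK hu hx p
  · obtain ⟨x, hx, hxt⟩ := exists_conjOn_eq hK hne.closure hu p
    by_cases hxS : x ∈ S
    · have := norm_mul_le_of_conjOn_eq hK hu hr.le hC' hx (hball x hxS) hxt
      linarith
    · have := le_conjOn hK hut hx p
      simp only [hηS x hxS, mul_zero, add_zero] at this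
      rwa [hxt]

end ConjugateDerivative

/-! ### The Euler–Lagrange inequality for admissible variations. -/

section EulerLagrange

variable {E : Type*} [NormedAddCommGroup E] [InnerProductSpace ℝ E] [FiniteDimensional ℝ E]
  [MeasurableSpace E] [BorelSpace E] {P S : Set E} {u η : E → ℝ}

theorem measurable_gradient_conjOn {K : Set E} (u : E → ℝ) :
    Measurable (gradient (conjOn K u)) :=
  (InnerProductSpace.toDual ℝ E).symm.continuous.measurable.comp
    (measurable_fderiv ℝ (conjOn K u))

omit [FiniteDimensional ℝ E] [MeasurableSpace E] [BorelSpace E] in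
theorem exists_conjOn_lipschitzWith {K : Set E} (hK : IsCompact K) (hne : K.Nonempty) :
    ∃ R : NNReal, ∀ u : E → ℝ, ContinuousOn u K → LipschitzWith R (conjOn K u) := by
  obtain ⟨C, hC⟩ := hK.isBounded.exists_norm_le
  exact ⟨C.toNNReal, fun u hu => conjOn_lipschitzWith hK hne hu fun x hx =>
    (hC x hx).trans (Real.le_coe_toNNReal C)⟩

theorem ae_differentiableAt_conjOn (ν : Measure E) [ν.IsAddHaarMeasure] {K : Set E}
    (hK : IsCompact K) (hne : K.Nonempty) (hu : ContinuousOn u K) :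
    ∀ᵐ p ∂ν, DifferentiableAt ℝ (conjOn K u) p := by
  obtain ⟨R, hR⟩ := exists_conjOn_lipschitzWith hK hne
  exact (hR u hu).ae_differentiableAt

theorem integrable_conjOn_variation (ν : Measure E) [ν.IsAddHaarMeasure] (ho : IsOpen P)
    (hK : IsCompact (closure P)) (hne : P.Nonempty) (hu : ContinuousOn u (closure P))
    (hη : Continuous η) (hS : IsCompact S) (hSP : S ⊆ P) (hηS : ∀ x, x ∉ S → η x = 0) {t : ℝ}
    (ht : t ∈ Ioc (0 : ℝ) 1) :
    Integrable (fun p => conjOn (closure P) (fun x => u x + t * η x) p - conjOn (closure P) u p)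
      ν := by
  obtain ⟨L, hL⟩ := exists_conjOn_lipschitzWith hK hne.closure
  obtain ⟨R, hR⟩ := exists_conjOn_variation_eq_zero ho hK hne hu hη hS hSP hηS
  have hut : ContinuousOn (fun x => u x + t * η x) (closure P) := by fun_prop
  refine ((hL _ hut).continuous.sub (hL _ hu).continuous).integrable_of_hasCompactSupport ?_
  refine HasCompactSupport.intro (isCompact_closedBall (0 : E) R) fun p hp => ?_
  rw [Metric.mem_closedBall, dist_zero_right, not_le] at hp
  simp [hR t ht p hp]

/-- Dominated convergence: the quotients are bounded by `max |η|`, vanish outside one ball, and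
converge wherever the conjugate is differentiable, which is almost everywhere by Rademacher. -/
theorem tendsto_integral_conjOn_variation (ν : Measure E) [ν.IsAddHaarMeasure] (ho : IsOpen P)
    (hK : IsCompact (closure P)) (hne : P.Nonempty) (hu : ContinuousOn u (closure P))
    (hη : Continuous η) (hS : IsCompact S) (hSP : S ⊆ P) (hηS : ∀ x, x ∉ S → η x = 0) :
    Tendsto (fun t : ℝ => ∫ p, (conjOn (closure P) (fun x => u x + t * η x) p
      - conjOn (closure P) u p) / t ∂ν) (𝓝[>] 0)
      (𝓝 (∫ p, -η (gradient (conjOn (closure P) u) p) ∂ν)) := by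
  obtain ⟨R, hR⟩ := exists_conjOn_variation_eq_zero ho hK hne hu hη hS hSP hηS
  obtain ⟨M, hM⟩ := (hK.image hη).isBounded.exists_norm_le
  have hM' : ∀ x ∈ closure P, |η x| ≤ M := fun x hx => hM _ ⟨x, hx, rfl⟩
  have hM0 : 0 ≤ M := (abs_nonneg _).trans (hM' _ (subset_closure hne.some_mem))
  have h01 : ∀ᶠ t : ℝ in 𝓝[>] 0, t ∈ Ioc (0 : ℝ) 1 := Ioc_mem_nhdsGT one_pos
  refine tendsto_integral_filter_of_dominated_convergence
    ((Metric.closedBall (0 : E) R).indicator fun _ => M) ?_ ?_ ?_ ?_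
  · filter_upwards [h01] with t ht
    exact ((integrable_conjOn_variation ν ho hK hne hu hη hS hSP hηS ht).div_const
      t).aestronglyMeasurable
  · filter_upwards [h01] with t ht
    refine Eventually.of_forall fun p => ?_
    by_cases hp : p ∈ Metric.closedBall (0 : E) R
    · rw [indicator_of_mem hp, norm_div, Real.norm_eq_abs, Real.norm_eq_abs, abs_of_pos ht.1,
        div_le_iff₀ ht.1, mul_comm]
      exact abs_conjOn_variation_le hK hne.closure hu hη hM' ht.1.le p
    · have hp' := hp
      rw [Metric.mem_closedBall, dist_zero_right, not_le] at hp'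
      simp [indicator_of_notMem hp, hR t ht p hp']
  · exact (integrable_indicator_iff Metric.isClosed_closedBall.measurableSet).2
      (integrableOn_const (by exact (isCompact_closedBall _ _).measure_lt_top.ne))
  · filter_upwards [ae_differentiableAt_conjOn ν hK hne.closure hu] with p hp
    exact tendsto_conjOn_variation hK hne.closure hu hη hp

omit [InnerProductSpace ℝ E] [FiniteDimensional ℝ E] in
theorem integrableOn_of_eq_zero_off_compact {μ : Measure E} (hη : Continuous η)
    (hS : IsCompact S) (hμS : μ S ≠ ∞) (hηS : ∀ x, x ∉ S → η x = 0) : Integrable η μ := by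
  obtain ⟨M, hM⟩ := (hS.image hη).isBounded.exists_norm_le
  rw [← integrableOn_iff_integrable_of_support_subset (s := S) fun x hx => by
    by_contra h; exact hx (hηS x h)]
  refine Measure.integrableOn_of_bounded (M := M) hμS hη.aestronglyMeasurable ?_
  filter_upwards [ae_restrict_mem hS.measurableSet] with x hx using hM _ ⟨x, hx, rfl⟩

/-- The Euler–Lagrange inequality of the Monge–Ampère energy. -/
theorem integral_gradient_conjOn_le (μ ν : Measure E) [ν.IsAddHaarMeasure] [Nontrivial E]
    (ho : IsOpen P) (hb : Bornology.IsBounded P) (hne : P.Nonempty) {φ w : E → ℝ}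
    (hφ : ContinuousOn φ (frontier P)) (hw : ContinuousOn w (closure P))
    (hμ : ∀ S ⊆ P, IsCompact S → μ S ≠ ∞)
    (huc : ContinuousOn u (closure P)) (huw : ∀ x ∈ closure P, w x ≤ u x)
    (huφ : ∀ x ∈ frontier P, u x = φ x)
    (hfin : mongeAmpereEnergy μ ν P φ w u (conjOn (closure P) u) ≠ ∞)
    (hmin : ∀ g : E → ℝ, ContinuousOn g (closure P) → (∀ x ∈ closure P, w x ≤ g x) →
        (∀ x ∈ frontier P, g x = φ x) →
        mongeAmpereEnergy μ ν P φ w u (conjOn (closure P) u) ≤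
          mongeAmpereEnergy μ ν P φ w g (conjOn (closure P) g))
    (hη : Continuous η) (hS : IsCompact S) (hSP : S ⊆ P) (hηS : ∀ x, x ∉ S → η x = 0)
    (hadm : ∀ᶠ t : ℝ in 𝓝[>] 0, ∀ x ∈ closure P, w x ≤ u x + t * η x) :
    ∫ p, η (gradient (conjOn (closure P) u) p) ∂ν ≤ ∫ x in P, η x ∂μ := by
  have hK : IsCompact (closure P) := hb.isCompact_closure
  have hcF := isCompact_frontier_of_isBounded hb
  have hneF := frontier_nonempty_of_isBounded hb hne
  set φs := conjOn (frontier P) φ with hφs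
  set U := conjOn (closure P) u with hU
  obtain ⟨L, hL⟩ := exists_conjOn_lipschitzWith hK hne.closure
  obtain ⟨L', hL'⟩ := exists_conjOn_lipschitzWith hcF hneF
  have hημ : Integrable η (μ.restrict P) := integrableOn_of_eq_zero_off_compact hη hS
    (((Measure.restrict_apply_le _ _).trans_lt (hμ S hSP hS).lt_top).ne) hηS
  have ha0 : 0 ≤ᵐ[μ.restrict P] fun x => u x - w x := by
    filter_upwards [ae_restrict_mem ho.measurableSet] with x hx
    exact sub_nonneg.2 (huw x (subset_closure hx))
  have ham : AEStronglyMeasurable (fun x => u x - w x) (μ.restrict P) :=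
    ((huc.sub hw).mono subset_closure).aestronglyMeasurable ho.measurableSet
  have hcmp : ∀ g : E → ℝ, ContinuousOn g (closure P) → (∀ x ∈ frontier P, g x = φ x) →
      ∀ p, φs p ≤ conjOn (closure P) g p := fun g hg hgφ =>
    conjOn_mono_set hK hneF hg frontier_subset_closure fun x hx => (hgφ x hx).le
  have hb0 : 0 ≤ᵐ[ν] fun p => U p - φs p :=
    Eventually.of_forall fun p => sub_nonneg.2 (hcmp u huc huφ p)
  have hbm : AEStronglyMeasurable (fun p => U p - φs p) ν :=
    ((hL u huc).continuous.sub (hL' φ hφ).continuous).aestronglyMeasurable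
  obtain ⟨hfin1, hfin2⟩ := ENNReal.add_ne_top.1 hfin
  have hai := (lintegral_ofReal_ne_top_iff_integrable ham ha0).1 hfin1
  have hbi := (lintegral_ofReal_ne_top_iff_integrable hbm hb0).1 hfin2
  -- Finiteness of the energy allows both terms to be rewritten as Bochner integrals, so that
  -- minimality can be subtracted and divided by `t`.
  have hkey : ∀ᶠ t : ℝ in 𝓝[>] 0, 0 ≤ ∫ x in P, η x ∂μ +
      ∫ p, (conjOn (closure P) (fun x => u x + t * η x) p - U p) / t ∂ν := by
    filter_upwards [hadm, Ioc_mem_nhdsGT one_pos] with t hadm ht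
    have hut : ContinuousOn (fun x => u x + t * η x) (closure P) := by fun_prop
    have hutφ : ∀ x ∈ frontier P, u x + t * η x = φ x := fun x hx => by
      rw [hηS x fun h => (ho.frontier_eq ▸ hx).2 (hSP h), mul_zero, add_zero, huφ x hx]
    set U' := conjOn (closure P) (fun x => u x + t * η x) with hU'
    have hdi : Integrable (fun p => U' p - U p) ν :=
      integrable_conjOn_variation ν ho hK hne huc hη hS hSP hηS ht
    have hE := hmin _ hut hadm hutφ
    have hai' : Integrable (fun x => u x - w x + t * η x) (μ.restrict P) :=
      hai.add (hημ.const_mul t)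
    have hbi' : Integrable (fun p => U p - φs p + (U' p - U p)) ν := hbi.add hdi
    have hat : ∫⁻ x in P, ENNReal.ofReal (u x + t * η x - w x) ∂μ =
        ENNReal.ofReal (∫ x in P, (u x - w x) ∂μ + t * ∫ x in P, η x ∂μ) := by
      rw [← integral_const_mul, ← integral_add hai (hημ.const_mul t),
        ofReal_integral_eq_lintegral_ofReal hai']
      · refine lintegral_congr fun x => ?_
        ring_nf
      · filter_upwards [ae_restrict_mem ho.measurableSet] with x hx
        have := hadm x (subset_closure hx)
        simp only [Pi.zero_apply]
        linarith
    have hbt : ∫⁻ p, ENNReal.ofReal (U' p - φs p) ∂ν =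
        ENNReal.ofReal (∫ p, (U p - φs p) ∂ν + ∫ p, (U' p - U p) ∂ν) := by
      rw [← integral_add hbi hdi, ofReal_integral_eq_lintegral_ofReal hbi']
      · refine lintegral_congr fun x => ?_
        ring_nf
      · refine Eventually.of_forall fun p => ?_
        have := hcmp _ hut hutφ p
        simp only [Pi.zero_apply]
        linarith
    have hat0 : 0 ≤ ∫ x in P, (u x - w x) ∂μ + t * ∫ x in P, η x ∂μ := by
      rw [← integral_const_mul, ← integral_add hai (hημ.const_mul t)]
      refine integral_nonneg_of_ae ?_
      filter_upwards [ae_restrict_mem ho.measurableSet] with x hx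
      have := hadm x (subset_closure hx)
      simp only [Pi.zero_apply]
      linarith
    have hbt0 : 0 ≤ ∫ p, (U p - φs p) ∂ν + ∫ p, (U' p - U p) ∂ν := by
      rw [← integral_add hbi hdi]
      refine integral_nonneg fun p => ?_
      have := hcmp _ hut hutφ p
      simp only [Pi.zero_apply]
      linarith
    rw [mongeAmpereEnergy, mongeAmpereEnergy, ← hφs, hat, hbt,
      ← ofReal_integral_eq_lintegral_ofReal hai ha0,
      ← ofReal_integral_eq_lintegral_ofReal hbi hb0,
      ← ENNReal.ofReal_add (integral_nonneg_of_ae ha0) (integral_nonneg_of_ae hb0),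
      ← ENNReal.ofReal_add hat0 hbt0, ENNReal.ofReal_le_ofReal_iff (add_nonneg hat0 hbt0)] at hE
    have h1 : 0 ≤ t * ∫ x in P, η x ∂μ + ∫ p, (U' p - U p) ∂ν := by linarith
    have h2 := div_nonneg h1 ht.1.le
    rwa [add_div, mul_div_cancel_left₀ _ ht.1.ne', ← integral_div] at h2
  have hlim := (tendsto_const_nhds (x := ∫ x in P, η x ∂μ)).add
    (tendsto_integral_conjOn_variation ν ho hK hne huc hη hS hSP hηS)
  have := ge_of_tendsto hlim hkey
  rw [integral_neg] at this
  linarith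

end EulerLagrange

/-! ### Comparing measures through test functions and open sets. -/

section MeasureComparison

variable {X : Type*} [NormedAddCommGroup X] [MeasurableSpace X] [BorelSpace X]

/-- The open set is an increasing union of closed sets, and a Urysohn function separating one of
these from the complement of `G` is an admissible test function. -/
theorem measure_le_of_forall_integral_le {m₁ m₂ : Measure X} {G : Set X} (hG : IsOpen G)
    (hGc : IsCompact (closure G)) (h₁ : m₁ (closure G) ≠ ∞) (h₂ : m₂ (closure G) ≠ ∞)
    (h : ∀ η : X → ℝ, Continuous η → (∀ x, 0 ≤ η x) → (∀ x, x ∉ closure G → η x = 0) →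
      ∫ x, η x ∂m₁ ≤ ∫ x, η x ∂m₂) : m₁ G ≤ m₂ G := by
  obtain ⟨F, hFc, hFG, hFU, hFm⟩ := hG.exists_iUnion_isClosed
  rw [← hFU, hFm.directed_le.measure_iUnion]
  refine iSup_le fun k => ?_
  rw [hFU]
  obtain ⟨f, hf0, hf1, hf⟩ := exists_continuous_zero_one_of_isClosed hG.isClosed_compl (hFc k)
    (disjoint_left.2 fun x hx hx' => hx (hFG k hx'))
  have hf0' : ∀ x, x ∉ closure G → f x = 0 := fun x hx => hf0 fun hx' => hx (subset_closure hx')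
  have hint : ∀ m : Measure X, m (closure G) ≠ ∞ → Integrable f m := fun m hm =>
    integrableOn_of_eq_zero_off_compact f.continuous hGc hm hf0'
  have hle := ENNReal.ofReal_le_ofReal (h f f.continuous (fun x => (hf x).1) hf0')
  rw [ofReal_integral_eq_lintegral_ofReal (hint m₁ h₁) (Eventually.of_forall fun x => (hf x).1),
    ofReal_integral_eq_lintegral_ofReal (hint m₂ h₂) (Eventually.of_forall fun x => (hf x).1)]
    at hle
  calc m₁ (F k) = ∫⁻ x in F k, 1 ∂m₁ := by simp
    _ ≤ ∫⁻ x in F k, ENNReal.ofReal (f x) ∂m₁ :=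
      setLIntegral_mono' (hFc k).measurableSet fun x hx => by simp [hf1 hx]
    _ ≤ ∫⁻ x, ENNReal.ofReal (f x) ∂m₁ := setLIntegral_le_lintegral _ _
    _ ≤ ∫⁻ x, ENNReal.ofReal (f x) ∂m₂ := hle
    _ ≤ ∫⁻ x, G.indicator 1 x ∂m₂ := lintegral_mono fun x => by
      by_cases hx : x ∈ G
      · simpa [hx] using (hf x).2
      · simp [hx, hf0 hx]
    _ = m₂ G := lintegral_indicator_one hG.measurableSet

/-- Exhaust `P` by the points at distance more than `1 / (k + 1)` from its complement; on each such
set the measures are finite and agree on the π-system of open sets. For empty complement `infDist`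
is zero and the exhaustion would be empty. -/
theorem measure_eq_of_forall_isOpen {m₁ m₂ : Measure X} {P : Set X} (hP : IsOpen P)
    (hne : Pᶜ.Nonempty)
    (hfin : ∀ G, IsOpen G → closure G ⊆ P → m₁ G ≠ ∞)
    (h : ∀ G, IsOpen G → closure G ⊆ P → m₁ G = m₂ G) {A : Set X} (hA : A ⊆ P) :
    m₁ A = m₂ A := by
  set G : ℕ → Set X := fun k => {x | (1 : ℝ) / (k + 1) < Metric.infDist x Pᶜ} with hGdef
  have hGo : ∀ k, IsOpen (G k) := fun k =>
    isOpen_lt continuous_const (Metric.continuous_infDist_pt _)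
  have hGP : ∀ k, closure (G k) ⊆ P := fun k x hx => by
    have h1 : (1 : ℝ) / (k + 1) ≤ Metric.infDist x Pᶜ :=
      closure_minimal (fun y hy => le_of_lt hy)
        (isClosed_le continuous_const (Metric.continuous_infDist_pt _)) hx
    by_contra hxP
    rw [Metric.infDist_zero_of_mem (show x ∈ Pᶜ from hxP)] at h1
    exact absurd h1 (not_le.2 (by positivity))
  have hU : P ⊆ ⋃ k, G k := fun x hx => by
    have hpos := (hP.isClosed_compl.notMem_iff_infDist_pos hne).1 (show x ∉ Pᶜ from fun h => h hx)
    obtain ⟨k, hk⟩ := exists_nat_one_div_lt hpos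
    exact mem_iUnion.2 ⟨k, hk⟩
  have hrest : ∀ k, m₁.restrict (G k) = m₂.restrict (G k) := fun k => by
    have : IsFiniteMeasure (m₁.restrict (G k)) :=
      ⟨by rw [Measure.restrict_apply_univ]; exact (hfin _ (hGo k) (hGP k)).lt_top⟩
    refine ext_of_generate_finite {s | IsOpen s} (BorelSpace.measurable_eq) isPiSystem_isOpen
      (fun s hs => ?_) ?_
    · rw [Measure.restrict_apply hs.measurableSet, Measure.restrict_apply hs.measurableSet]
      exact h _ (hs.inter (hGo k)) ((closure_mono inter_subset_right).trans (hGP k))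
    · rw [Measure.restrict_apply_univ, Measure.restrict_apply_univ]
      exact h _ (hGo k) (hGP k)
  have := Measure.restrict_iUnion_congr.2 hrest
  rw [← Measure.restrict_eq_self m₁ (hA.trans hU), this, Measure.restrict_eq_self m₂ (hA.trans hU)]

end MeasureComparison

/-! ### Monge–Ampère mass and the comparison principle. -/

section Subdifferential

variable {n : ℕ} {P : Set (EuclideanSpace ℝ (Fin n))} {u w φ : EuclideanSpace ℝ (Fin n) → ℝ}

theorem mem_subdifferential_iff (hK : IsCompact (closure P)) (hu : ContinuousOn u (closure P))
    {x p : EuclideanSpace ℝ (Fin n)} (hx : x ∈ P) :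
    p ∈ subdifferential P u x ↔ conjOn (closure P) u p = ⟪p, x⟫ - u x := by
  constructor
  · intro h
    refine le_antisymm (conjOn_le ⟨x, subset_closure hx⟩ fun y hy => ?_)
      (le_conjOn hK hu (subset_closure hx) p)
    have := le_on_closure (f := fun y => u x + ⟪p, y - x⟫) (g := u) h (by fun_prop) hu hy
    simp only [inner_sub_right] at this
    linarith
  · intro h y hy
    have := le_conjOn hK hu (subset_closure hy) p
    rw [inner_sub_right]
    linarith

/-- Where the conjugate is differentiable at `p`, its gradient is the only point of the closure at
which the slope `p` can support `u`. The exceptional slopes are Lebesgue-null, so the union of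
subdifferentials agrees almost everywhere with a preimage under the gradient. -/
theorem mongeAmpereMass_eq_map (hK : IsCompact (closure P)) (hu : ContinuousOn u (closure P))
    {A : Set (EuclideanSpace ℝ (Fin n))} (hA : A ⊆ P) (hAm : MeasurableSet A) :
    mongeAmpereMass P u A = (volume.map (gradient (conjOn (closure P) u))) A := by
  rw [Measure.map_apply (measurable_gradient_conjOn u) hAm]
  rcases A.eq_empty_or_nonempty with rfl | hAne
  · simp [mongeAmpereMass]
  have hne : (closure P).Nonempty := (hAne.mono hA).closure
  refine measure_congr ?_
  filter_upwards [ae_differentiableAt_conjOn volume hK hne hu] with p hp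
  refine propext ?_
  change p ∈ ⋃ x ∈ A, subdifferential P u x ↔ gradient (conjOn (closure P) u) p ∈ A
  simp only [mem_iUnion, exists_prop]
  constructor
  · rintro ⟨x, hx, h⟩
    rw [mem_subdifferential_iff hK hu (hA hx)] at h
    rwa [eq_gradient_conjOn hK hu hp (subset_closure (hA hx)) h]
  · intro h
    exact ⟨_, h, (mem_subdifferential_iff hK hu (hA h)).2 (gradient_conjOn_mem hK hne hu hp).2⟩

theorem mongeAmpereMass_ne_top (ho : IsOpen P) (hK : IsCompact (closure P))
    (hu : ContinuousOn u (closure P)) {S : Set (EuclideanSpace ℝ (Fin n))} (hS : IsCompact S)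
    (hSP : S ⊆ P) : mongeAmpereMass P u S ≠ ∞ := by
  obtain ⟨r, hr, hball⟩ := exists_closedBall_subset_closure ho hS hSP
  obtain ⟨C, hC⟩ := (hK.image_of_continuousOn hu).isBounded.exists_norm_le
  have hsub : (⋃ x ∈ S, subdifferential P u x) ⊆ Metric.closedBall 0 (2 * C / r) := by
    refine iUnion₂_subset fun x hx p hp => ?_
    rw [mem_subdifferential_iff hK hu (hSP hx)] at hp
    have := norm_mul_le_of_conjOn_eq hK hu hr.le (fun y hy => hC _ ⟨y, hy, rfl⟩)
      (subset_closure (hSP hx)) (hball x hx) hp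
    rw [Metric.mem_closedBall, dist_zero_right, le_div_iff₀ hr]
    linarith
  exact ((measure_mono hsub).trans_lt (isCompact_closedBall _ _).measure_lt_top).ne

/-- If `w ≤ u` on the boundary, the slopes of `w` over `{u < w}` are slopes of `u` there. -/
theorem iUnion_subdifferential_subset (ho : IsOpen P) (hK : IsCompact (closure P))
    (hu : ContinuousOn u (closure P)) (hw : ContinuousOn w (closure P))
    (hle : ∀ x ∈ frontier P, w x ≤ u x) :
    (⋃ x ∈ {x ∈ P | u x < w x}, subdifferential P w x) ⊆
      ⋃ x ∈ {x ∈ P | u x < w x}, subdifferential P u x := by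
  refine iUnion₂_subset fun x hx p hp => ?_
  rw [mem_subdifferential_iff hK hw hx.1] at hp
  -- Lower a plane of slope `p` until it supports `u`, say at `y`. As `u < w` at `x`, the plane lies
  -- strictly below the one supporting `w`, so `u y < w y`, and `y` cannot be on the frontier.
  obtain ⟨y, hy, h⟩ := exists_conjOn_eq hK ⟨x, subset_closure hx.1⟩ hu p
  have h1 := le_conjOn hK hw hy p
  have h2 := le_conjOn hK hu (subset_closure hx.1) p
  have h3 := hx.2
  have hlt : u y < w y := by linarith
  have hyP : y ∈ P := by
    by_contra hyP
    exact absurd (hle y (mem_frontier_of_mem_closure_of_notMem ho hy hyP)) (not_le.2 hlt)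
  exact mem_iUnion₂.2 ⟨y, ⟨hyP, hlt⟩, (mem_subdifferential_iff hK hu hyP).2 h⟩

theorem closure_setOf_lt_subset (ho : IsOpen P)
    (hu : ContinuousOn u (closure P)) (hw : ContinuousOn w (closure P))
    (hlt : ∀ x ∈ frontier P, w x < u x) : closure {x ∈ P | u x < w x} ⊆ P := by
  intro x hx
  have hxK : x ∈ closure P := closure_mono (sep_subset _ _) hx
  have hle : u x ≤ w x := by
    have hsub : closure {x ∈ P | u x < w x} ⊆ closure P := closure_mono (sep_subset _ _)
    exact le_on_closure (f := u) (g := w) (s := {x ∈ P | u x < w x})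
      (fun y hy => hy.2.le) (hu.mono hsub) (hw.mono hsub) hx
  by_contra hxP
  exact absurd (hlt x (mem_frontier_of_mem_closure_of_notMem ho hxK hxP)) (not_lt.2 hle)

theorem isOpen_setOf_lt (ho : IsOpen P)
    (hu : ContinuousOn u (closure P)) (hw : ContinuousOn w (closure P)) :
    IsOpen {x ∈ P | u x < w x} := by
  have h : ContinuousOn (fun x => w x - u x) P := (hw.sub hu).mono subset_closure
  convert h.isOpen_inter_preimage ho (isOpen_Ioi (a := 0)) using 1
  ext x
  simp

theorem subdifferential_const_mul_add {a b : ℝ} (ha : 0 < a) (x : EuclideanSpace ℝ (Fin n)) :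
    subdifferential P (fun x => a * w x + b) x = a • subdifferential P w x := by
  ext p
  rw [mem_smul_set_iff_inv_smul_mem₀ ha.ne']
  refine forall₂_congr fun y _ => ?_
  rw [inner_smul_left]
  simp only [conj_trivial]
  rw [← mul_le_mul_iff_right₀ ha (b := w x + _), mul_add, mul_inv_cancel_left₀ ha.ne']
  constructor <;> intro h <;> linarith

theorem mongeAmpereMass_const_mul_add {a b : ℝ} (ha : 0 < a)
    (A : Set (EuclideanSpace ℝ (Fin n))) :
    mongeAmpereMass P (fun x => a * w x + b) A =
      ENNReal.ofReal (a ^ n) * mongeAmpereMass P w A := by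
  simp only [mongeAmpereMass, subdifferential_const_mul_add ha]
  rw [← smul_set_iUnion₂, Measure.addHaar_smul, finrank_euclideanSpace_fin,
    abs_of_pos (pow_pos ha n)]

/-- The comparison principle for the Monge–Ampère equation. -/
theorem le_of_mongeAmpereMass_le (hn : 1 ≤ n) (ho : IsOpen P) (hK : IsCompact (closure P))
    {μ : Measure (EuclideanSpace ℝ (Fin n))} (hμK : ∀ S ⊆ P, IsCompact S → μ S ≠ ∞)
    (hμpos : ∀ G ⊆ P, IsOpen G → G.Nonempty → μ G ≠ 0)
    (hu : ContinuousOn u (closure P)) (hw : ContinuousOn w (closure P))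
    (hmu : ∀ G, IsOpen G → closure G ⊆ P → mongeAmpereMass P u G ≤ μ G)
    (hmw : ∀ G, IsOpen G → closure G ⊆ P → μ G ≤ mongeAmpereMass P w G)
    (hle : ∀ x ∈ frontier P, w x ≤ u x) : ∀ x ∈ closure P, w x ≤ u x := by
  intro x₀ hx₀
  by_contra! hlt
  have hx₀P : x₀ ∈ P := by
    by_contra h
    exact absurd (hle _ (mem_frontier_of_mem_closure_of_notMem ho hx₀ h)) (not_le.2 hlt)
  obtain ⟨B, hB⟩ := (hK.image_of_continuousOn hw).isBounded.exists_norm_le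
  have hB' : ∀ x ∈ closure P, |w x| ≤ B := fun x hx => hB _ ⟨x, hx, rfl⟩
  have hB0 : 0 ≤ B := (abs_nonneg _).trans (hB' _ hx₀)
  set m := w x₀ - u x₀ with hm
  have hm0 : 0 < m := sub_pos.2 hlt
  set δ := m / (8 * (B + 1)) with hδ
  have hδ0 : 0 < δ := by positivity
  have hδB : δ * (2 * B) ≤ m / 4 := by
    rw [hδ, div_mul_eq_mul_div, div_le_div_iff₀ (by positivity) (by positivity)]
    nlinarith
  -- The dilation by `1 + δ` multiplies the mass by `(1 + δ) ^ n > 1`; the constant puts `w'`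
  -- strictly below `u` on the frontier. Since `2 * δ * B ≤ m / 4`, it still exceeds `u` at `x₀`. On
  -- `G` this yields `(1 + δ) ^ n * μ G ≤ μ G` with `0 < μ G < ∞`.
  set w' : EuclideanSpace ℝ (Fin n) → ℝ := fun x => (1 + δ) * w x + (-(δ * B) - m / 4) with hw'
  have hw'c : ContinuousOn w' (closure P) := by fun_prop
  have hlt' : ∀ x ∈ frontier P, w' x < u x := fun x hx => by
    have h1 := hle x hx
    have h2 : δ * w x ≤ δ * B := by
      gcongr; exact (abs_le.1 (hB' x (frontier_subset_closure hx))).2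
    simp only [hw']
    linarith
  set G := {x ∈ P | u x < w' x} with hG
  have hGo : IsOpen G := isOpen_setOf_lt ho hu hw'c
  have hGP : closure G ⊆ P := closure_setOf_lt_subset ho hu hw'c hlt'
  have hGK : IsCompact (closure G) := hK.of_isClosed_subset isClosed_closure
    (hGP.trans subset_closure)
  have hxG : x₀ ∈ G := ⟨hx₀P, by
    have h2 : δ * -B ≤ δ * w x₀ := by gcongr; exact (abs_le.1 (hB' x₀ hx₀)).1
    simp only [hw']
    linarith⟩
  have hfin : μ G ≠ ∞ := ((measure_mono subset_closure).trans_lt (hμK _ hGP hGK).lt_top).ne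
  have hpos : μ G ≠ 0 := hμpos G (sep_subset _ _) hGo ⟨x₀, hxG⟩
  have h1 : mongeAmpereMass P w' G ≤ μ G :=
    (measure_mono (iUnion_subdifferential_subset ho hK hu hw'c fun x hx => (hlt' x hx).le)).trans
      (hmu G hGo hGP)
  rw [hw', mongeAmpereMass_const_mul_add (by positivity)] at h1
  have h2 : ENNReal.ofReal ((1 + δ) ^ n) * μ G ≤ 1 * μ G := by
    rw [one_mul]
    exact (mul_le_mul_right (hmw G hGo hGP) _).trans h1
  rw [ENNReal.mul_le_mul_iff_left hpos hfin, ENNReal.ofReal_le_one] at h2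
  exact absurd h2 (not_le.2 (one_lt_pow₀ (by linarith) (by omega)))

end Subdifferential

/-! ### Existence and uniqueness from a subsolution. -/

section Existence

variable {n : ℕ} {P : Set (EuclideanSpace ℝ (Fin n))}

theorem nontrivial_euclideanSpace (hn : 1 ≤ n) : Nontrivial (EuclideanSpace ℝ (Fin n)) :=
  Module.nontrivial_of_finrank_pos (R := ℝ) (by rw [finrank_euclideanSpace_fin]; omega)

/-- Solvability of the Dirichlet problem for the Monge–Ampère equation with right hand side `μ`,
given a convex subsolution `v` with zero boundary values. -/
theorem exists_mongeAmpereMass_eq (hn : 1 ≤ n) (ho : IsOpen P) (hc : Convex ℝ P)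
    (hb : Bornology.IsBounded P) (hne : P.Nonempty) {μ : Measure (EuclideanSpace ℝ (Fin n))}
    (hμK : ∀ S ⊆ P, IsCompact S → μ S ≠ ∞) (hμpos : ∀ G ⊆ P, IsOpen G → G.Nonempty → μ G ≠ 0)
    {v φ : EuclideanSpace ℝ (Fin n) → ℝ} (hv : ContinuousOn v (closure P))
    (hvc : ConvexOn ℝ (closure P) v) (hv0 : ∀ x ∈ frontier P, v x = 0) (hvneg : ∀ x ∈ P, v x < 0)
    (hvint : ∫⁻ x in P, ENNReal.ofReal (-v x) ∂μ ≠ ∞)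
    (hvMA : ∀ (p : EuclideanSpace ℝ (Fin n)) (b : ℝ) (G), IsOpen G → closure G ⊆ P →
      μ G ≤ mongeAmpereMass P (fun x => v x + (⟪p, x⟫ - b)) G)
    (hφ : ContinuousOn φ (frontier P)) (hs : IsAffinelySupported (frontier P) φ) :
    ∃ u, ConvexOn ℝ (closure P) u ∧ ContinuousOn u (closure P) ∧
      (∀ x ∈ frontier P, u x = φ x) ∧ ∀ A ⊆ P, MeasurableSet A → mongeAmpereMass P u A = μ A := by
  have := nontrivial_euclideanSpace hn
  have hK : IsCompact (closure P) := hb.isCompact_closure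
  set φb := conjUniv (conjOn (frontier P) φ) with hφb
  have hbd := fun x (hx : x ∈ closure P) =>
    bddAbove_range_of_conjOn_le ho hc hb hφ (fun _ => le_rfl) hx
  have hφbc : ConvexOn ℝ (closure P) φb := convexOn_conjUniv hc.closure hbd
  have hφb' : ContinuousOn φb (closure P) := continuousOn_conjUniv_conjOn ho hc hb hne hφ hs
  -- Comparison will give `u ≥ φb + v`; the factor `2` leaves the gap `-v > 0` above the obstacle.
  set w : EuclideanSpace ℝ (Fin n) → ℝ := fun x => φb x + 2 * v x with hw
  have hwc : ContinuousOn w (closure P) := by fun_prop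
  have hwconv : ConvexOn ℝ (closure P) w := hφbc.add (hvc.smul (by norm_num : (0 : ℝ) ≤ 2))
  have hwφ : ∀ x ∈ frontier P, w x = φ x := fun x hx => by
    simp only [hw, hv0 x hx, mul_zero, add_zero]
    exact conjUniv_conjOn_frontier ho hc hb hφ hs hx
  have hfin : ∫⁻ x in P, ENNReal.ofReal (φb x - w x) ∂μ ≠ ∞ := by
    have : ∀ x, ENNReal.ofReal (φb x - w x) = 2 * ENNReal.ofReal (-v x) := fun x => by
      rw [show φb x - w x = 2 * -v x by simp only [hw]; ring, ENNReal.ofReal_mul (by norm_num)]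
      simp
    simp only [this]
    rw [lintegral_const_mul' _ _ (by simp)]
    exact ENNReal.mul_ne_top (by simp) hvint
  obtain ⟨u, hucv, hu, huw, huφ, hEfin, hmin⟩ := exists_mongeAmpereEnergy_minimizer μ volume ho hc
    hb hne hφ hwc hwconv hwφ hfin
  have hEL := fun η hη S hS hSP hηS => integral_gradient_conjOn_le (η := η) (S := S) μ volume ho hb
    hne hφ hwc hμK hu huw huφ hEfin hmin hη hS hSP hηS
  set T := gradient (conjOn (closure P) u) with hT
  have hTm : Measurable T := measurable_gradient_conjOn u
  set N := (volume : Measure (EuclideanSpace ℝ (Fin n))).map T with hN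
  have hmass : ∀ A ⊆ P, MeasurableSet A → mongeAmpereMass P u A = N A := fun A hA hAm =>
    mongeAmpereMass_eq_map hK hu hA hAm
  have hcl : ∀ G, closure G ⊆ P → IsCompact (closure G) := fun G hG =>
    hK.of_isClosed_subset isClosed_closure (hG.trans subset_closure)
  have hNfin : ∀ G, closure G ⊆ P → N (closure G) ≠ ∞ := fun G hG => by
    rw [← hmass _ hG isClosed_closure.measurableSet]
    exact mongeAmpereMass_ne_top ho hK hu (hcl G hG) hG
  have hNint : ∀ η : EuclideanSpace ℝ (Fin n) → ℝ, Continuous η →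
      ∫ x, η x ∂N = ∫ p, η (T p) := fun η hη =>
    integral_map hTm.aemeasurable hη.aestronglyMeasurable
  have hμint : ∀ (η : EuclideanSpace ℝ (Fin n) → ℝ) (G), closure G ⊆ P →
      (∀ x, x ∉ closure G → η x = 0) → ∫ x in P, η x ∂μ = ∫ x, η x ∂μ := fun η G hG h0 =>
    setIntegral_eq_integral_of_forall_compl_eq_zero fun x hx => h0 x fun h => hx (hG h)
  -- Nonnegative variations respect the obstacle.
  have hNle : ∀ G, IsOpen G → closure G ⊆ P → N G ≤ μ G := fun G hGo hG => by
    refine measure_le_of_forall_integral_le hGo (hcl G hG) (hNfin G hG) (hμK _ hG (hcl G hG))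
      fun η hη hη0 hηG => ?_
    rw [hNint η hη, ← hμint η G hG hηG]
    refine hEL η hη _ (hcl G hG) hG hηG ?_
    filter_upwards [self_mem_nhdsWithin] with t (ht : 0 < t) x hx
    exact (huw x hx).trans (le_add_of_nonneg_right (mul_nonneg ht.le (hη0 x)))
  have hmassle : ∀ G, IsOpen G → closure G ⊆ P → mongeAmpereMass P u G ≤ μ G := fun G hGo hG => by
    rw [hmass G (subset_closure.trans hG) hGo.measurableSet]
    exact hNle G hGo hG
  have hlow : ∀ x ∈ closure P, φb x ≤ u x - v x := fun x hx => conjUniv_le fun p => by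
    have := le_of_mongeAmpereMass_le hn ho hK hμK hμpos hu
      (w := fun x => v x + (⟪p, x⟫ - conjOn (frontier P) φ p)) (by fun_prop) hmassle
      (hvMA p _) (fun y hy => by
        have h1 := le_conjOn (isCompact_frontier_of_isBounded hb) hφ hy p
        rw [hv0 y hy, huφ y hy]
        linarith) x hx
    linarith
  have hstrict : ∀ x ∈ P, w x < u x := fun x hx => by
    have h1 := hlow x (subset_closure hx)
    have h2 := hvneg x hx
    simp only [hw]
    linarith
  -- Strict separation from the obstacle, uniform on the compact `closure G`, now admits small
  -- negative variations.
  have hμle : ∀ G, IsOpen G → closure G ⊆ P → μ G ≤ N G := fun G hGo hG => by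
    refine measure_le_of_forall_integral_le hGo (hcl G hG) (hμK _ hG (hcl G hG)) (hNfin G hG)
      fun η hη hη0 hηG => ?_
    rw [hNint η hη, ← hμint η G hG hηG]
    have h := hEL (fun x => -η x) hη.neg _ (hcl G hG) hG (fun x hx => by rw [hηG x hx, neg_zero]) ?_
    · simp only [integral_neg] at h
      linarith
    obtain ⟨M, hM⟩ := (hK.image hη).isBounded.exists_norm_le
    have hγ : ∃ γ > 0, ∀ x ∈ closure G, γ ≤ u x - w x := by
      rcases (closure G).eq_empty_or_nonempty with he | hne'
      · exact ⟨1, one_pos, fun x hx => by simp [he] at hx⟩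
      obtain ⟨y, hy, hmin⟩ := (hcl G hG).exists_isMinOn hne' (f := fun x => u x - w x)
        ((hu.sub hwc).mono (hG.trans subset_closure))
      exact ⟨u y - w y, sub_pos.2 (hstrict y (hG hy)), fun x hx => hmin hx⟩
    obtain ⟨γ, hγ0, hγ⟩ := hγ
    have hsmall : ∀ᶠ t : ℝ in 𝓝[>] 0, t * M < γ := by
      have : Tendsto (fun t : ℝ => t * M) (𝓝[>] 0) (𝓝 (0 * M)) :=
        ((continuous_id.mul continuous_const).tendsto 0).mono_left nhdsWithin_le_nhds
      rw [zero_mul] at this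
      exact this.eventually (gt_mem_nhds hγ0)
    filter_upwards [hsmall, self_mem_nhdsWithin] with t hts (ht : 0 < t) x hx
    by_cases hxG : x ∈ closure G
    · have h1 := hγ x hxG
      have h2 : t * η x ≤ t * M := by
        gcongr
        exact (le_abs_self _).trans (hM _ ⟨x, hx, rfl⟩)
      linarith
    · rw [hηG x hxG, neg_zero, mul_zero, add_zero]
      exact huw x hx
  refine ⟨u, hucv, hu, huφ, fun A hA hAm => ?_⟩
  rw [hmass A hA hAm]
  refine measure_eq_of_forall_isOpen ho ?_ (fun G hGo hG =>
    ((measure_mono subset_closure).trans_lt (hNfin G hG).lt_top).ne)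
    (fun G hGo hG => le_antisymm (hNle G hGo hG) (hμle G hGo hG)) hA
  obtain ⟨x, hx⟩ := frontier_nonempty_of_isBounded hb hne
  exact ⟨x, (ho.frontier_eq ▸ hx).2⟩

/-- Uniqueness for the Dirichlet problem for the Monge–Ampère equation. -/
theorem eqOn_of_mongeAmpereMass_eq (hn : 1 ≤ n) (ho : IsOpen P)
    (hb : Bornology.IsBounded P) {μ : Measure (EuclideanSpace ℝ (Fin n))}
    (hμK : ∀ S ⊆ P, IsCompact S → μ S ≠ ∞) (hμpos : ∀ G ⊆ P, IsOpen G → G.Nonempty → μ G ≠ 0)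
    {u w : EuclideanSpace ℝ (Fin n) → ℝ} (hu : ContinuousOn u (closure P))
    (hw : ContinuousOn w (closure P)) (hφ : ∀ x ∈ frontier P, w x = u x)
    (hmu : ∀ A ⊆ P, MeasurableSet A → mongeAmpereMass P u A = μ A)
    (hmw : ∀ A ⊆ P, MeasurableSet A → mongeAmpereMass P w A = μ A) : EqOn w u (closure P) := by
  have hK : IsCompact (closure P) := hb.isCompact_closure
  have hmu' := fun G (hG : IsOpen G) (hGP : closure G ⊆ P) =>
    hmu G (subset_closure.trans hGP) hG.measurableSet
  have hmw' := fun G (hG : IsOpen G) (hGP : closure G ⊆ P) =>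
    hmw G (subset_closure.trans hGP) hG.measurableSet
  exact fun x hx => le_antisymm
    (le_of_mongeAmpereMass_le hn ho hK hμK hμpos hu hw (fun G h h' => (hmu' G h h').le)
      (fun G h h' => (hmw' G h h').ge) (fun y hy => (hφ y hy).le) x hx)
    (le_of_mongeAmpereMass_le hn ho hK hμK hμpos hw hu (fun G h h' => (hmw' G h h').le)
      (fun G h h' => (hmu' G h h').ge) (fun y hy => (hφ y hy).ge) x hx)

end Existence

/-! ### Determinants of symmetric operators. -/

section Determinant

variable {E : Type*} [NormedAddCommGroup E] [InnerProductSpace ℝ E] [FiniteDimensional ℝ E]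

theorem LinearMap.det_adjoint_real (f : E →ₗ[ℝ] E) :
    LinearMap.det (LinearMap.adjoint f) = LinearMap.det f := by
  set b := stdOrthonormalBasis ℝ E
  rw [← LinearMap.det_toMatrix b.toBasis, ← LinearMap.det_toMatrix b.toBasis,
    LinearMap.toMatrix_adjoint, Matrix.det_conjTranspose]
  simp

/-- Monotonicity of the determinant on symmetric operators. -/
theorem LinearMap.IsSymmetric.sq_det_le_det {A B : E →ₗ[ℝ] E} (hA : A.IsSymmetric)
    (hB : LinearMap.det B ≠ 0) (h : ∀ ξ, ‖B ξ‖ ^ 2 ≤ ⟪A ξ, ξ⟫) :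
    LinearMap.det B ^ 2 ≤ LinearMap.det A := by
  set e := LinearMap.equivOfDetNeZero B hB with he
  set C : E →ₗ[ℝ] E := e.symm.toLinearMap with hC
  have hBC : ∀ ξ, B (C ξ) = ξ := fun ξ => e.apply_symm_apply ξ
  -- Conjugating by `C = B⁻¹` turns the hypothesis into `⟪M v, v⟫ ≥ ‖v‖ ^ 2`, so all eigenvalues of
  -- `M` are at least one.
  set M : E →ₗ[ℝ] E := LinearMap.adjoint C ∘ₗ A ∘ₗ C with hM
  have hMs : M.IsSymmetric := fun x y => by
    simp only [hM, LinearMap.comp_apply]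
    rw [LinearMap.adjoint_inner_left, LinearMap.adjoint_inner_right]
    exact hA _ _
  have hMi : ∀ v, ⟪M v, v⟫ = ⟪A (C v), C v⟫ := fun v => by
    rw [hM, LinearMap.comp_apply, LinearMap.comp_apply, LinearMap.adjoint_inner_left]
  have hMdet : 1 ≤ LinearMap.det M := by
    rw [hMs.det_eq_prod_eigenvalues rfl]
    refine Finset.one_le_prod fun i _ => ?_
    set v := hMs.eigenvectorBasis rfl i with hv
    have hv1 : ‖v‖ = 1 := (hMs.eigenvectorBasis rfl).orthonormal.1 i
    have h1 : ⟪M v, v⟫ = hMs.eigenvalues rfl i := by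
      rw [hv, hMs.apply_eigenvectorBasis, inner_smul_left, ← hv, real_inner_self_eq_norm_sq, hv1]
      simp
    have h2 := h (C v)
    rw [hBC, hv1] at h2
    rw [hMi] at h1
    change (1 : ℝ) ≤ hMs.eigenvalues rfl i
    rw [← h1]
    simpa using h2
  have hdet : LinearMap.det M = LinearMap.det C ^ 2 * LinearMap.det A := by
    rw [hM, LinearMap.det_comp, LinearMap.det_comp, LinearMap.det_adjoint_real]
    ring
  have hCB : LinearMap.det B * LinearMap.det C = 1 := by
    rw [← LinearMap.det_comp, show B ∘ₗ C = LinearMap.id from LinearMap.ext hBC, LinearMap.det_id]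
  calc LinearMap.det B ^ 2 ≤ LinearMap.det B ^ 2 * LinearMap.det M :=
        le_mul_of_one_le_right (sq_nonneg _) hMdet
    _ = (LinearMap.det B * LinearMap.det C) ^ 2 * LinearMap.det A := by rw [hdet]; ring
    _ = LinearMap.det A := by rw [hCB]; ring

end Determinant

/-! ### Frames of facet functions and convexity of the boundary data. -/

section PolytopeGeometry

variable {n N : ℕ} {l : Fin N → EuclideanSpace ℝ (Fin n) →ᵃ[ℝ] ℝ}

/-- The gradient of an affine function. -/
noncomputable def affineGradient (f : EuclideanSpace ℝ (Fin n) →ᵃ[ℝ] ℝ) :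
    EuclideanSpace ℝ (Fin n) :=
  (InnerProductSpace.toDual ℝ _).symm (LinearMap.toContinuousLinearMap f.linear)

theorem inner_affineGradient (f : EuclideanSpace ℝ (Fin n) →ᵃ[ℝ] ℝ)
    (ξ : EuclideanSpace ℝ (Fin n)) : ⟪affineGradient f, ξ⟫ = f.linear ξ := by
  simp [affineGradient]

theorem affine_eq_add_inner (f : EuclideanSpace ℝ (Fin n) →ᵃ[ℝ] ℝ)
    (x y : EuclideanSpace ℝ (Fin n)) : f y = f x + ⟪affineGradient f, y - x⟫ := by
  have := f.linearMap_vsub y x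
  rw [vsub_eq_sub, vsub_eq_sub] at this
  rw [inner_affineGradient, this]
  ring

theorem affine_combination (f : EuclideanSpace ℝ (Fin n) →ᵃ[ℝ] ℝ)
    (x y : EuclideanSpace ℝ (Fin n)) {a b : ℝ} (hab : a + b = 1) :
    f (a • x + b • y) = a * f x + b * f y := by
  have := Convex.combo_affine_apply (f := f) (x := x) (y := y) hab
  simpa using this

theorem continuous_affine (f : EuclideanSpace ℝ (Fin n) →ᵃ[ℝ] ℝ) : Continuous f :=
  f.continuous_of_finiteDimensional

theorem isOpen_polytope : IsOpen (polytope l) := by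
  simp only [polytope, ofPred_forall]
  exact isOpen_iInter_of_finite fun i => isOpen_lt continuous_const (continuous_affine _)

theorem convex_polytope : Convex ℝ (polytope l) := by
  intro x hx y hy a b ha hb hab i
  rw [affine_combination _ _ _ hab]
  rcases ha.eq_or_lt with rfl | ha'
  · rw [zero_add] at hab; simp [hab, hy i]
  · exact add_pos_of_pos_of_nonneg (mul_pos ha' (hx i)) (mul_nonneg hb (hy i).le)

theorem nonneg_of_mem_closure_polytope {x : EuclideanSpace ℝ (Fin n)}
    (hx : x ∈ closure (polytope l)) (i : Fin N) : 0 ≤ l i x :=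
  closure_minimal (fun _ hy => (hy i).le : polytope l ⊆ {y | 0 ≤ l i y})
    (isClosed_le continuous_const (continuous_affine _)) hx

theorem mem_closure_polytope (hne : (polytope l).Nonempty) {x : EuclideanSpace ℝ (Fin n)}
    (hx : ∀ i, 0 ≤ l i x) : x ∈ closure (polytope l) := by
  obtain ⟨z, hz⟩ := hne
  have hlim : Tendsto (fun t : ℝ => (1 - t) • x + t • z) (𝓝[>] 0) (𝓝 x) := by
    have : Continuous fun t : ℝ => (1 - t) • x + t • z := by fun_prop
    have h := this.tendsto 0
    simp only [sub_zero, one_smul, zero_smul, add_zero] at h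
    exact h.mono_left nhdsWithin_le_nhds
  refine mem_closure_of_tendsto hlim ?_
  filter_upwards [Ioc_mem_nhdsGT one_pos] with t ht i
  rw [affine_combination _ _ _ (by ring)]
  exact add_pos_of_nonneg_of_pos (mul_nonneg (sub_nonneg.2 ht.2) (hx i)) (mul_pos ht.1 (hz i))

theorem exists_eq_zero_of_mem_frontier {x : EuclideanSpace ℝ (Fin n)}
    (hx : x ∈ frontier (polytope l)) : ∃ i, l i x = 0 := by
  rw [isOpen_polytope.frontier_eq] at hx
  by_contra! h
  exact hx.2 fun i => (nonneg_of_mem_closure_polytope hx.1 i).lt_of_ne' (h i)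

/-- The linear map whose components are the differentials of `l (σ j)`. -/
noncomputable def frameMap (l : Fin N → EuclideanSpace ℝ (Fin n) →ᵃ[ℝ] ℝ) (σ : Fin n → Fin N) :
    EuclideanSpace ℝ (Fin n) →ₗ[ℝ] EuclideanSpace ℝ (Fin n) :=
  (WithLp.linearEquiv 2 ℝ (Fin n → ℝ)).symm.toLinearMap ∘ₗ
    LinearMap.pi fun j => (l (σ j)).linear

theorem frameMap_apply (σ : Fin n → Fin N) (ξ : EuclideanSpace ℝ (Fin n)) (j : Fin n) :
    frameMap l σ ξ j = (l (σ j)).linear ξ := rfl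

/-- Along such a `ξ` the active constraints stay zero and the others stay positive for small steps
both ways, so a nonzero `ξ` would put the vertex inside a segment. -/
theorem eq_zero_of_forall_linear_eq_zero (hl : IsSimplePolytope l) {v ξ : EuclideanSpace ℝ (Fin n)}
    (hv : v ∈ (closure (polytope l)).extremePoints ℝ)
    (hξ : ∀ i, l i v = 0 → (l i).linear ξ = 0) : ξ = 0 := by
  have hev : ∀ i, ∀ᶠ t : ℝ in 𝓝[>] 0, 0 ≤ l i (v + t • ξ) ∧ 0 ≤ l i (v + t • -ξ) := fun i => by
    have hval : ∀ (t : ℝ) (η : EuclideanSpace ℝ (Fin n)), l i (v + t • η) =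
        l i v + t * (l i).linear η := fun t η => by
      rw [affine_eq_add_inner (l i) v, inner_affineGradient]; simp
    rcases (nonneg_of_mem_closure_polytope hv.1 i).eq_or_lt with h0 | hpos
    · refine Eventually.of_forall fun t => ?_
      rw [hval, hval, ← h0, map_neg, hξ i h0.symm]
      simp
    · have h1 : ∀ η : EuclideanSpace ℝ (Fin n), ∀ᶠ t : ℝ in 𝓝[>] 0, 0 ≤ l i (v + t • η) :=
        fun η => by
        have hc : Continuous fun t : ℝ => l i (v + t • η) :=
          (continuous_affine (l i)).comp (by fun_prop)
        have := hc.tendsto 0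
        simp only [zero_smul, add_zero] at this
        filter_upwards [nhdsWithin_le_nhds (this.eventually (lt_mem_nhds hpos))] with t ht
          using le_of_lt ht
      exact (h1 ξ).and (h1 (-ξ))
  obtain ⟨t, ht, htpos⟩ := ((eventually_all.2 hev).and self_mem_nhdsWithin).exists
  have h1 := mem_closure_polytope hl.nonempty fun i => (ht i).1
  have h2 := mem_closure_polytope hl.nonempty fun i => (ht i).2
  have hseg : v ∈ openSegment ℝ (v + t • ξ) (v + t • -ξ) :=
    ⟨1 / 2, 1 / 2, by norm_num, by norm_num, by norm_num, by module⟩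
  have h3 : v + t • ξ = v := hv.2 h1 h2 hseg
  have h4 : t • ξ = 0 := by simpa using h3
  exact (smul_eq_zero.1 h4).resolve_left (ne_of_gt htpos)

/-- Near every point of a simple polytope there is a frame of facet functions containing all those
that vanish at the point. -/
theorem IsSimplePolytope.exists_frame (hl : IsSimplePolytope l) {x : EuclideanSpace ℝ (Fin n)}
    (hx : x ∈ closure (polytope l)) :
    ∃ σ : Fin n → Fin N, Function.Injective σ ∧ LinearMap.det (frameMap l σ) ≠ 0 ∧
      ∀ i ∉ range σ, 0 < l i x := by
  classical
  have hK : IsCompact (closure (polytope l)) := hl.bounded.isCompact_closure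
  -- An extreme point of the smallest face `F` through `x` is a vertex of the polytope. Every `l i`
  -- vanishing at `x` vanishes there, and by simplicity exactly `n` do, which form the frame.
  set F := {y ∈ closure (polytope l) | ∀ i, l i x = 0 → l i y = 0} with hF
  have hFc : IsCompact F := by
    refine hK.inter_right (t := {y | ∀ i, l i x = 0 → l i y = 0}) ?_
    simp only [ofPred_forall]
    exact isClosed_iInter fun i => isClosed_iInter fun _ =>
      isClosed_eq (continuous_affine _) continuous_const
  obtain ⟨v, hvF, hvext⟩ := hFc.extremePoints_nonempty ⟨x, hx, fun i h => h⟩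
  have hv : v ∈ (closure (polytope l)).extremePoints ℝ := by
    refine ⟨hvF.1, fun x₁ h₁ x₂ h₂ hseg => ?_⟩
    have hz : ∀ i, l i x = 0 → l i x₁ = 0 ∧ l i x₂ = 0 := fun i hi => by
      obtain ⟨a, b, ha, hb, hab, rfl⟩ := hseg
      have h0 := hvF.2 i hi
      rw [affine_combination _ _ _ hab] at h0
      have p1 := mul_nonneg ha.le (nonneg_of_mem_closure_polytope h₁ i)
      have p2 := mul_nonneg hb.le (nonneg_of_mem_closure_polytope h₂ i)
      exact ⟨(mul_eq_zero.1 (by linarith : a * l i x₁ = 0)).resolve_left ha.ne',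
        (mul_eq_zero.1 (by linarith : b * l i x₂ = 0)).resolve_left hb.ne'⟩
    exact hvext ⟨h₁, fun i hi => (hz i hi).1⟩ ⟨h₂, fun i hi => (hz i hi).2⟩ hseg
  set J : Finset (Fin N) := Finset.univ.filter fun i => l i v = 0 with hJ
  have hJcard : J.card = n := by
    rw [← hl.simple v hv, ← Set.ncard_coe_finset]
    congr 1
    ext i
    simp [hJ, polytopeFacet, hvF.1]
  have hrange : range (J.orderEmbOfFin hJcard) = J := J.range_orderEmbOfFin hJcard
  refine ⟨J.orderEmbOfFin hJcard, (J.orderEmbOfFin hJcard).injective, ?_, fun i hi => ?_⟩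
  · rw [Ne, LinearMap.det_eq_zero_iff_ker_ne_bot, not_not, LinearMap.ker_eq_bot']
    intro ξ hξ
    refine eq_zero_of_forall_linear_eq_zero hl hv fun i hi => ?_
    have hiJ : i ∈ range (J.orderEmbOfFin hJcard) := by rw [hrange]; simp [hJ, hi]
    obtain ⟨j, rfl⟩ := hiJ
    rw [← frameMap_apply, hξ]
    rfl
  · refine (nonneg_of_mem_closure_polytope hx i).lt_of_ne' fun h0 => hi ?_
    rw [hrange]
    simp [hJ, hvF.2 i h0]

/-- A frame at `x` serves a whole neighbourhood by continuity of the complementary product;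
compactness makes the constant uniform. -/
theorem IsSimplePolytope.exists_uniform_frame (hl : IsSimplePolytope l) :
    ∃ c > 0, ∀ x ∈ closure (polytope l), ∃ σ : Fin n → Fin N, Function.Injective σ ∧
      c ≤ LinearMap.det (frameMap l σ) ^ 2 ∧ c ≤ ∏ i ∈ (Finset.univ.image σ)ᶜ, l i x := by
  have hK : IsCompact (closure (polytope l)) := hl.bounded.isCompact_closure
  refine hK.induction_on (p := fun S => ∃ c > 0, ∀ x ∈ S, ∃ σ : Fin n → Fin N,
    Function.Injective σ ∧ c ≤ LinearMap.det (frameMap l σ) ^ 2 ∧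
      c ≤ ∏ i ∈ (Finset.univ.image σ)ᶜ, l i x) ⟨1, one_pos, by simp⟩ ?_ ?_ ?_
  · rintro S T hST ⟨c, hc, h⟩
    exact ⟨c, hc, fun x hx => h x (hST hx)⟩
  · rintro S T ⟨c, hc, h⟩ ⟨d, hd, h'⟩
    refine ⟨min c d, lt_min hc hd, fun x hx => ?_⟩
    rcases hx with hx | hx
    · obtain ⟨σ, h1, h2, h3⟩ := h x hx
      exact ⟨σ, h1, (min_le_left _ _).trans h2, (min_le_left _ _).trans h3⟩
    · obtain ⟨σ, h1, h2, h3⟩ := h' x hx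
      exact ⟨σ, h1, (min_le_right _ _).trans h2, (min_le_right _ _).trans h3⟩
  · intro x hx
    obtain ⟨σ, h1, h2, h3⟩ := hl.exists_frame hx
    have hpos : 0 < ∏ i ∈ (Finset.univ.image σ)ᶜ, l i x := by
      refine Finset.prod_pos fun i hi => h3 i ?_
      rintro ⟨j, rfl⟩
      simp at hi
    have hcont : Continuous fun y => ∏ i ∈ (Finset.univ.image σ)ᶜ, l i y :=
      continuous_finsetProd _ fun i _ => continuous_affine _
    refine ⟨{y | (∏ i ∈ (Finset.univ.image σ)ᶜ, l i x) / 2 < ∏ i ∈ (Finset.univ.image σ)ᶜ, l i y},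
      nhdsWithin_le_nhds (hcont.continuousAt.eventually (lt_mem_nhds (half_lt_self hpos))),
      min (LinearMap.det (frameMap l σ) ^ 2) ((∏ i ∈ (Finset.univ.image σ)ᶜ, l i x) / 2),
      lt_min (by positivity) (by positivity), fun y hy => ⟨σ, h1, min_le_left _ _, ?_⟩⟩
    exact (min_le_right _ _).trans (le_of_lt hy)

theorem prod_eq_prod_frame_mul (x : EuclideanSpace ℝ (Fin n)) {σ : Fin n → Fin N}
    (hσ : Function.Injective σ) :
    ∏ i, l i x = (∏ j, l (σ j) x) * ∏ i ∈ (Finset.univ.image σ)ᶜ, l i x := by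
  rw [← Finset.prod_mul_prod_compl (Finset.univ.image σ) (fun i => l i x),
    Finset.prod_image fun a _ b _ h => hσ h]

/-- On the facet through `x`, convexity gives an affine minorant. Lowered by the margin `d - c` it
lies strictly below `φ` on the facet, and subtracting a large multiple of `l i`, which is zero on
the facet and positive off it, pushes it below `φ` on the whole closure. -/
theorem isAffinelySupported_frontier_polytope (hb : Bornology.IsBounded (polytope l))
    {φ : EuclideanSpace ℝ (Fin n) → ℝ} (hφ : ContinuousOn φ (closure (polytope l)))
    (hφc : ∀ i, ConvexOn ℝ (polytopeFacet l i) φ) :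
    IsAffinelySupported (frontier (polytope l)) φ := by
  intro x hx c hcx
  obtain ⟨i, hi⟩ := exists_eq_zero_of_mem_frontier hx
  have hK : IsCompact (closure (polytope l)) := hb.isCompact_closure
  have hxK := frontier_subset_closure hx
  obtain ⟨d, hcd, hd⟩ := exists_between hcx
  have hFsub : polytopeFacet l i ⊆ closure (polytope l) := sep_subset _ _
  have hFcl : IsClosed (polytopeFacet l i) :=
    isClosed_closure.inter (isClosed_eq (continuous_affine (l i)) continuous_const)
  obtain ⟨L, b, hL, hLx⟩ := ConvexOn.exists_affine_le_of_lt (𝕜 := ℝ) (s := polytopeFacet l i)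
    ⟨hxK, hi⟩ hd hFcl (hφ.mono hFsub).lowerSemicontinuousOn (hφc i)
  obtain ⟨p, rfl⟩ := (InnerProductSpace.toDual ℝ (EuclideanSpace ℝ (Fin n))).surjective L
  have hL' : ∀ y ∈ polytopeFacet l i, ⟪p, y⟫ + b ≤ φ y := fun y hy => by
    simpa [InnerProductSpace.toDual_apply_apply] using hL ⟨y, hy⟩
  have hLx' : ⟪p, x⟫ + b = d := by
    simpa [InnerProductSpace.toDual_apply_apply] using hLx
  set f : EuclideanSpace ℝ (Fin n) → ℝ := fun y => φ y - (⟪p, y⟫ + b) + (d - c) with hf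
  have hfc : ContinuousOn f (closure (polytope l)) := by fun_prop
  obtain ⟨M, hM⟩ := (hK.image_of_continuousOn hfc).isBounded.exists_norm_le
  have hM' : ∀ y ∈ closure (polytope l), |f y| ≤ M := fun y hy => hM _ ⟨y, hy, rfl⟩
  have hM0 : 0 ≤ M := (abs_nonneg _).trans (hM' x hxK)
  have hS : IsCompact (closure (polytope l) ∩ f ⁻¹' Iic 0) :=
    hK.of_isClosed_subset (hfc.preimage_isClosed_of_isClosed isClosed_closure isClosed_Iic)
      inter_subset_left
  have hA : ∃ A : ℝ, 0 ≤ A ∧ ∀ y ∈ closure (polytope l), 0 ≤ f y + A * l i y := by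
    rcases (closure (polytope l) ∩ f ⁻¹' Iic 0).eq_empty_or_nonempty with he | hSne
    · refine ⟨0, le_rfl, fun y hy => ?_⟩
      by_contra! h
      have : y ∈ closure (polytope l) ∩ f ⁻¹' Iic 0 := ⟨hy, by
        simp only [mem_preimage, mem_Iic]; linarith⟩
      rw [he] at this
      exact this
    · obtain ⟨y₀, hy₀, hmin⟩ := hS.exists_isMinOn hSne (continuous_affine (l i)).continuousOn
      have hpos : 0 < l i y₀ := by
        refine (nonneg_of_mem_closure_polytope hy₀.1 i).lt_of_ne' fun h0 => ?_
        have h1 := hL' y₀ ⟨hy₀.1, h0⟩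
        have h2 : f y₀ ≤ 0 := hy₀.2
        simp only [hf] at h2
        linarith
      refine ⟨M / l i y₀, by positivity, fun y hy => ?_⟩
      by_cases hfy : f y ≤ 0
      · have h1 : l i y₀ ≤ l i y := hmin ⟨hy, hfy⟩
        have h2 := (abs_le.1 (hM' y hy)).1
        have h3 : M ≤ M / l i y₀ * l i y := by
          calc M = M / l i y₀ * l i y₀ := by field_simp
            _ ≤ _ := by gcongr
        linarith
      · have := mul_nonneg (div_nonneg hM0 hpos.le) (nonneg_of_mem_closure_polytope hy i)
        push Not at hfy
        linarith
  obtain ⟨A, hA0, hA⟩ := hA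
  have hexp : ∀ y, ⟪p - A • affineGradient (l i), y⟫ + (b - (d - c) - A * l i 0) =
      ⟪p, y⟫ + b - (d - c) - A * l i y := fun y => by
    have h1 := affine_eq_add_inner (l i) 0 y
    rw [sub_zero] at h1
    rw [h1, inner_sub_left, inner_smul_left]
    simp only [conj_trivial]
    ring
  refine ⟨p - A • affineGradient (l i), b - (d - c) - A * l i 0, fun y hy => ?_, ?_⟩
  · rw [hexp]
    have := hA y (frontier_subset_closure hy)
    simp only [hf] at this
    linarith
  · rw [hexp, hi]
    linarith

end PolytopeGeometry

/-! ### Concavity and Hessian of a power of the product of the facet functions. -/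

section Barrier

variable {n N : ℕ}

/-- A power of the product of the defining functions of a polytope; its negative multiples are
the convex subsolutions used as barriers. -/
noncomputable def facetMean (l : Fin N → EuclideanSpace ℝ (Fin n) →ᵃ[ℝ] ℝ)
    (x : EuclideanSpace ℝ (Fin n)) : ℝ :=
  (∏ i, l i x) ^ (2 * N : ℝ)⁻¹

/-- The logarithmic gradient of the product of the defining functions of a polytope. -/
noncomputable def facetLogGradient (l : Fin N → EuclideanSpace ℝ (Fin n) →ᵃ[ℝ] ℝ)
    (x : EuclideanSpace ℝ (Fin n)) : EuclideanSpace ℝ (Fin n) :=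
  ∑ i, (l i x)⁻¹ • affineGradient (l i)

/-- Minus the gradient of `facetMean`. -/
noncomputable def facetMeanNegGradient (l : Fin N → EuclideanSpace ℝ (Fin n) →ᵃ[ℝ] ℝ)
    (x : EuclideanSpace ℝ (Fin n)) : EuclideanSpace ℝ (Fin n) :=
  -(((2 * N : ℝ)⁻¹ * facetMean l x) • facetLogGradient l x)

/-- Minus the Hessian of `facetMean`. -/
noncomputable def facetMeanNegHessian (l : Fin N → EuclideanSpace ℝ (Fin n) →ᵃ[ℝ] ℝ)
    (x : EuclideanSpace ℝ (Fin n)) :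
    EuclideanSpace ℝ (Fin n) →L[ℝ] EuclideanSpace ℝ (Fin n) :=
  ((2 * N : ℝ)⁻¹ * facetMean l x) •
    (∑ i, ((l i x) ^ 2)⁻¹ • (innerSL ℝ (affineGradient (l i))).smulRight (affineGradient (l i))
      - (2 * N : ℝ)⁻¹ • (innerSL ℝ (facetLogGradient l x)).smulRight (facetLogGradient l x))

variable {l : Fin N → EuclideanSpace ℝ (Fin n) →ᵃ[ℝ] ℝ} {x y : EuclideanSpace ℝ (Fin n)}

theorem prod_pos_of_mem_polytope (hx : x ∈ polytope l) : 0 < ∏ i, l i x :=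
  Finset.prod_pos fun i _ => hx i

theorem facetMean_pos (hx : x ∈ polytope l) : 0 < facetMean l x :=
  Real.rpow_pos_of_pos (prod_pos_of_mem_polytope hx) _

theorem continuous_facetMean : Continuous (facetMean l) :=
  (continuous_finsetProd _ fun i _ => continuous_affine (l i)).rpow_const
    fun _ => Or.inr (by positivity)

theorem facetMean_eq_zero {i : Fin N} (hi : l i x = 0) : facetMean l x = 0 := by
  have hN : (0 : ℝ) < N := by exact_mod_cast i.pos
  rw [facetMean, Finset.prod_eq_zero (Finset.mem_univ i) hi, Real.zero_rpow (by positivity)]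

theorem hasFDerivAt_affine (f : EuclideanSpace ℝ (Fin n) →ᵃ[ℝ] ℝ) (x : EuclideanSpace ℝ (Fin n)) :
    HasFDerivAt f (innerSL ℝ (affineGradient f)) x := by
  have h : (f : EuclideanSpace ℝ (Fin n) → ℝ) =
      fun y => innerSL ℝ (affineGradient f) y + f 0 := by
    funext y
    rw [affine_eq_add_inner f 0 y, sub_zero, innerSL_apply_apply]
    ring
  rw [h]
  exact (innerSL ℝ (affineGradient f)).hasFDerivAt.add_const _

theorem hasFDerivAt_facetMean (hx : x ∈ polytope l) :
    HasFDerivAt (facetMean l)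
      (((2 * N : ℝ)⁻¹ * facetMean l x) • innerSL ℝ (facetLogGradient l x)) x := by
  have hlog : HasFDerivAt (fun y => ∑ i, Real.log (l i y))
      (∑ i, (l i x)⁻¹ • innerSL ℝ (affineGradient (l i))) x :=
    HasFDerivAt.fun_sum fun i _ => (hasFDerivAt_affine (l i) x).log (hx i).ne'
  have hval : ∀ y ∈ polytope l, facetMean l y =
      Real.exp ((2 * N : ℝ)⁻¹ * ∑ i, Real.log (l i y)) := fun y hy => by
    rw [facetMean, Real.rpow_def_of_pos (prod_pos_of_mem_polytope hy),
      Real.log_prod fun i _ => (hy i).ne', mul_comm]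
  have h := (hlog.const_mul (2 * N : ℝ)⁻¹).exp
  refine (h.congr_of_eventuallyEq ?_).congr_fderiv ?_
  · filter_upwards [isOpen_polytope.mem_nhds hx] with y hy using hval y hy
  · rw [← hval x hx]
    ext ξ
    simp only [facetLogGradient, map_sum, map_smul, smul_apply,
      sum_apply, smul_eq_mul]
    ring

theorem hasFDerivAt_facetLogGradient (hx : x ∈ polytope l) :
    HasFDerivAt (facetLogGradient l)
      (-∑ i, ((l i x) ^ 2)⁻¹ •
        (innerSL ℝ (affineGradient (l i))).smulRight (affineGradient (l i))) x := by
  have h : HasFDerivAt (fun y => ∑ i, (l i y)⁻¹ • affineGradient (l i)) (∑ i,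
      ((-((l i x) ^ 2)⁻¹) • innerSL ℝ (affineGradient (l i))).smulRight (affineGradient (l i))) x :=
    HasFDerivAt.fun_sum fun i _ =>
      ((hasDerivAt_inv (hx i).ne').comp_hasFDerivAt x (hasFDerivAt_affine (l i) x)).smul_const _
  refine h.congr_fderiv ?_
  ext1 ξ
  simp [smul_smul, Finset.sum_neg_distrib]

theorem hasFDerivAt_facetMeanNegGradient (hx : x ∈ polytope l) :
    HasFDerivAt (facetMeanNegGradient l) (facetMeanNegHessian l x) x := by
  have h := (((hasFDerivAt_facetMean hx).const_mul (2 * N : ℝ)⁻¹).smul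
    (hasFDerivAt_facetLogGradient hx)).neg
  refine h.congr_fderiv ?_
  ext1 ξ
  simp only [facetMeanNegHessian, neg_apply, add_apply,
    smul_apply, sub_apply,
    ContinuousLinearMap.smulRight_apply, smul_eq_mul]
  module

theorem inner_facetLogGradient (ξ : EuclideanSpace ℝ (Fin n)) :
    ⟪facetLogGradient l x, ξ⟫ = ∑ i, (l i x)⁻¹ * (l i).linear ξ := by
  rw [facetLogGradient, sum_inner]
  refine Finset.sum_congr rfl fun i _ => ?_
  rw [inner_smul_left, inner_affineGradient]
  simp

/-- In terms of the ratios `l i y / l i x` this is the arithmetic–geometric mean inequality for the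
exponent `1 / N`, followed by Bernoulli for the square root. -/
theorem facetMean_le (hx : x ∈ polytope l) (hy : y ∈ closure (polytope l)) :
    facetMean l y ≤ facetMean l x + ⟪((2 * N : ℝ)⁻¹ * facetMean l x) • facetLogGradient l x,
      y - x⟫ := by
  rcases Nat.eq_zero_or_pos N with rfl | hNpos
  · simp [facetMean, facetLogGradient]
  have hN : (0 : ℝ) < N := by exact_mod_cast hNpos
  set r : Fin N → ℝ := fun i => l i y / l i x with hr
  have hr0 : ∀ i, 0 ≤ r i := fun i => div_nonneg (nonneg_of_mem_closure_polytope hy i) (hx i).le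
  have hprod : ∏ i, l i y = (∏ i, l i x) * ∏ i, r i := by
    rw [← Finset.prod_mul_distrib]
    refine Finset.prod_congr rfl fun i _ => ?_
    rw [hr, mul_div_cancel₀ _ (hx i).ne']
  have hR0 : 0 ≤ ∏ i, r i := Finset.prod_nonneg fun i _ => hr0 i
  have hmean : (∏ i, r i) ^ (N : ℝ)⁻¹ ≤ ∑ i, (N : ℝ)⁻¹ * r i := by
    rw [← Real.finsetProd_rpow _ _ fun i _ => hr0 i]
    refine Real.geom_mean_le_arith_mean_weighted _ (fun _ => (N : ℝ)⁻¹) _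
      (fun _ _ => by positivity) ?_ fun i _ => hr0 i
    simp [hN.ne']
  have hbern : (∏ i, r i) ^ (2 * N : ℝ)⁻¹ ≤ 1 + 1 / 2 * ((∏ i, r i) ^ (N : ℝ)⁻¹ - 1) := by
    have h1 := rpow_one_add_le_one_add_mul_self (s := (∏ i, r i) ^ (N : ℝ)⁻¹ - 1)
      (by linarith [Real.rpow_nonneg hR0 (N : ℝ)⁻¹]) (p := 1 / 2) (by norm_num) (by norm_num)
    rw [add_sub_cancel, ← Real.rpow_mul hR0] at h1
    rwa [mul_inv_rev, show (2 : ℝ)⁻¹ = 1 / 2 by norm_num]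
  have hsum : ⟪facetLogGradient l x, y - x⟫ = ∑ i, (r i - 1) := by
    rw [inner_facetLogGradient]
    refine Finset.sum_congr rfl fun i _ => ?_
    have h1 := affine_eq_add_inner (l i) x y
    rw [inner_affineGradient] at h1
    have := (hx i).ne'
    simp only [hr]
    field_simp
    linarith
  have hfac : facetMean l y = facetMean l x * (∏ i, r i) ^ (2 * N : ℝ)⁻¹ := by
    rw [facetMean, hprod, Real.mul_rpow (prod_pos_of_mem_polytope hx).le hR0, facetMean]
  have hle : (∏ i, r i) ^ (2 * N : ℝ)⁻¹ ≤ 1 + (2 * N : ℝ)⁻¹ * ∑ i, (r i - 1) := by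
    rw [← Finset.mul_sum] at hmean
    rw [Finset.sum_sub_distrib]
    simp only [Finset.sum_const, Finset.card_univ, Fintype.card_fin, nsmul_eq_mul, mul_one]
    have : (2 * N : ℝ)⁻¹ * (∑ i, r i - N) = 1 / 2 * ((N : ℝ)⁻¹ * ∑ i, r i - 1) := by
      field_simp
    rw [this]
    linarith
  rw [inner_smul_left, hsum, hfac]
  simp only [conj_trivial]
  have := mul_le_mul_of_nonneg_left hle (facetMean_pos hx).le
  linarith

theorem concaveOn_facetMean : ConcaveOn ℝ (closure (polytope l)) (facetMean l) := by
  refine ⟨convex_polytope.closure, fun x hx y hy a b ha hb hab => ?_⟩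
  simp only [smul_eq_mul]
  rcases ha.eq_or_lt with rfl | ha'
  · rw [zero_add] at hab; simp [hab]
  rcases hb.eq_or_lt with rfl | hb'
  · rw [add_zero] at hab; simp [hab]
  set z := a • x + b • y with hz
  have hzK : z ∈ closure (polytope l) := convex_polytope.closure hx hy ha hb hab
  by_cases hzP : z ∈ polytope l
  · have h1 := mul_le_mul_of_nonneg_left (facetMean_le hzP hx) ha
    have h2 := mul_le_mul_of_nonneg_left (facetMean_le hzP hy) hb
    set q := ((2 * N : ℝ)⁻¹ * facetMean l z) • facetLogGradient l z
    have h3 : a * ⟪q, x - z⟫ + b * ⟪q, y - z⟫ = 0 := by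
      rw [← inner_smul_right, ← inner_smul_right, ← inner_add_right]
      have : a • (x - z) + b • (y - z) = 0 := by
        have h4 : a • (x - z) + b • (y - z) = (a • x + b • y) - (a + b) • z := by module
        rw [h4, hab, one_smul, sub_self]
      rw [this, inner_zero_right]
    have h5 : a * facetMean l z + b * facetMean l z = facetMean l z := by
      rw [← add_mul, hab, one_mul]
    linarith
  -- No tangent plane is available at a frontier point, but then both endpoints lie on the same
  -- facet and all three values are zero.
  · obtain ⟨i, hi⟩ := exists_eq_zero_of_mem_frontier
      (mem_frontier_of_mem_closure_of_notMem isOpen_polytope hzK hzP)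
    have h0 := hi
    rw [hz, affine_combination _ _ _ hab] at h0
    have p1 := mul_nonneg ha (nonneg_of_mem_closure_polytope hx i)
    have p2 := mul_nonneg hb (nonneg_of_mem_closure_polytope hy i)
    have q1 : l i x = 0 := (mul_eq_zero.1 (by linarith : a * l i x = 0)).resolve_left ha'.ne'
    have q2 : l i y = 0 := (mul_eq_zero.1 (by linarith : b * l i y = 0)).resolve_left hb'.ne'
    rw [facetMean_eq_zero q1, facetMean_eq_zero q2, facetMean_eq_zero hi]
    simp

theorem inner_facetMeanNegHessian (ξ η : EuclideanSpace ℝ (Fin n)) :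
    ⟪facetMeanNegHessian l x ξ, η⟫ = (2 * N : ℝ)⁻¹ * facetMean l x *
      (∑ i, ((l i x)⁻¹ * (l i).linear ξ) * ((l i x)⁻¹ * (l i).linear η) -
        (2 * N : ℝ)⁻¹ * ((∑ i, (l i x)⁻¹ * (l i).linear ξ) *
          ∑ i, (l i x)⁻¹ * (l i).linear η)) := by
  simp only [facetMeanNegHessian, smul_apply, sub_apply,
    sum_apply, ContinuousLinearMap.smulRight_apply, innerSL_apply_apply,
    inner_smul_left, inner_sub_left, sum_inner, inner_affineGradient, inner_facetLogGradient,
    conj_trivial]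
  congr 2
  refine Finset.sum_congr rfl fun i _ => ?_
  ring

theorem isSymmetric_facetMeanNegHessian :
    (facetMeanNegHessian l x : EuclideanSpace ℝ (Fin n) →ₗ[ℝ] _).IsSymmetric := fun ξ η => by
  rw [ContinuousLinearMap.coe_coe, real_inner_comm (facetMeanNegHessian l x η) ξ,
    inner_facetMeanNegHessian, inner_facetMeanNegHessian]
  simp only [mul_comm ((l _ x)⁻¹ * (l _).linear ξ) ((l _ x)⁻¹ * (l _).linear η),
    mul_comm (∑ i, (l i x)⁻¹ * (l i).linear ξ)]

/-- By Cauchy–Schwarz the negative rank-one term costs at most half of the sum of squares. This is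
why the exponent is `1 / (2N)`: with `1 / N` it could cancel the sum completely. -/
theorem le_inner_facetMeanNegHessian (hx : x ∈ polytope l) {σ : Fin n → Fin N}
    (hσ : Function.Injective σ) (ξ : EuclideanSpace ℝ (Fin n)) :
    (2 * N : ℝ)⁻¹ * facetMean l x / 2 * ∑ j, ((l (σ j) x)⁻¹ * (l (σ j)).linear ξ) ^ 2 ≤
      ⟪facetMeanNegHessian l x ξ, ξ⟫ := by
  rcases Nat.eq_zero_or_pos N with rfl | hNpos
  · simp [inner_facetMeanNegHessian]
  have hN : (0 : ℝ) < N := by exact_mod_cast hNpos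
  rw [inner_facetMeanNegHessian]
  set t : Fin N → ℝ := fun i => (l i x)⁻¹ * (l i).linear ξ with ht
  have h1 : (∑ i, t i) ^ 2 ≤ N * ∑ i, t i ^ 2 := by
    simpa using sq_sum_le_card_mul_sum_sq (s := Finset.univ) (f := t)
  have h2 : ∑ j, t (σ j) ^ 2 ≤ ∑ i, t i ^ 2 := by
    rw [← Finset.sum_image (s := Finset.univ) (g := σ) (f := fun i => t i ^ 2)
      fun a _ b _ h => hσ h]
    exact Finset.sum_le_univ_sum_of_nonneg fun i => sq_nonneg _
  have h3 : (2 * N : ℝ)⁻¹ * (∑ i, t i) ^ 2 ≤ (∑ i, t i ^ 2) / 2 := by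
    calc (2 * N : ℝ)⁻¹ * (∑ i, t i) ^ 2 ≤ (2 * N : ℝ)⁻¹ * (N * ∑ i, t i ^ 2) := by gcongr
      _ = (∑ i, t i ^ 2) / 2 := by field_simp
  have hg := facetMean_pos hx
  have h4 : ∑ i, t i * t i = ∑ i, t i ^ 2 := Finset.sum_congr rfl fun i _ => (sq _).symm
  change _ ≤ (2 * N : ℝ)⁻¹ * facetMean l x * (∑ i, t i * t i - (2 * N : ℝ)⁻¹ *
    ((∑ i, t i) * ∑ i, t i))
  rw [h4, ← sq, div_mul_eq_mul_div, mul_div_assoc]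
  gcongr
  linarith

end Barrier

/-! ### The barrier as a subsolution. -/

section Subsolution

variable {n N : ℕ} {l : Fin N → EuclideanSpace ℝ (Fin n) →ᵃ[ℝ] ℝ} {x : EuclideanSpace ℝ (Fin n)}

/-- The diagonal operator with entries `d`. -/
noncomputable def diagonalMap (d : Fin n → ℝ) :
    EuclideanSpace ℝ (Fin n) →ₗ[ℝ] EuclideanSpace ℝ (Fin n) :=
  (Matrix.diagonal d).toEuclideanLin

theorem diagonalMap_apply (d : Fin n → ℝ) (ξ : EuclideanSpace ℝ (Fin n)) (j : Fin n) :
    diagonalMap d ξ j = d j * ξ j := by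
  simp [diagonalMap, Matrix.toLpLin_apply, Matrix.mulVec_diagonal]

theorem det_diagonalMap (d : Fin n → ℝ) : LinearMap.det (diagonalMap d) = ∏ j, d j := by
  rw [diagonalMap, Matrix.toEuclideanLin_eq_toLin_orthonormal, LinearMap.det_toLin,
    Matrix.det_diagonal]

theorem exists_prod_le (hb : Bornology.IsBounded (polytope l)) :
    ∃ M : ℝ, 1 ≤ M ∧ ∀ x ∈ polytope l, ∏ i, l i x ≤ M ∧ ∀ i, l i x ≤ M := by
  have hK : IsCompact (closure (polytope l)) := hb.isCompact_closure
  obtain ⟨M, hM⟩ := (hK.image (continuous_finsetProd Finset.univ fun i _ =>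
    continuous_affine (l i))).isBounded.exists_norm_le
  have h := fun i => (hK.image (continuous_affine (l i))).isBounded.exists_norm_le
  choose M' hM' using h
  have hM0 : ∀ i, M' i ≤ ∑ i, |M' i| := fun i => (le_abs_self _).trans
    (Finset.single_le_sum (f := fun i => |M' i|) (fun i _ => abs_nonneg _) (Finset.mem_univ i))
  refine ⟨max (max 1 M) (∑ i, |M' i|), (le_max_left _ _).trans (le_max_left _ _),
    fun x hx => ⟨?_, fun i => ?_⟩⟩
  · exact ((le_abs_self _).trans (hM _ ⟨x, subset_closure hx, rfl⟩)).trans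
      ((le_max_right _ _).trans (le_max_left _ _))
  · exact ((le_abs_self _).trans (hM' i _ ⟨x, subset_closure hx, rfl⟩)).trans
      ((hM0 i).trans (le_max_right _ _))

/-- In frame coordinates the Hessian dominates `diag (a g / (2 l²))`, whose determinant is of order
`g ^ n / r ^ 2`. As `n ≤ N`, the exponent of the product in `g ^ n` is at most one, so `g ^ n` is at
least a multiple of `∏ l i`, while `1 / r ≥ c / ∏ l i`. -/
theorem IsSimplePolytope.exists_hessian_lower_bound (hn : 1 ≤ n) (hl : IsSimplePolytope l) :
    ∃ κ > 0, ∀ x ∈ polytope l, ∃ B : EuclideanSpace ℝ (Fin n) →ₗ[ℝ] EuclideanSpace ℝ (Fin n),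
      LinearMap.det B ≠ 0 ∧ (∀ ξ, ‖B ξ‖ ^ 2 ≤ ⟪facetMeanNegHessian l x ξ, ξ⟫) ∧
      κ / ∏ i, l i x ≤ LinearMap.det B ^ 2 := by
  obtain ⟨c, hc, hframe⟩ := hl.exists_uniform_frame
  obtain ⟨M, hM1, hM⟩ := exists_prod_le hl.bounded
  have hM0 : 0 < M := by linarith
  have hnN : n ≤ N := by
    obtain ⟨x, hx⟩ := hl.nonempty
    obtain ⟨σ, hσ, -⟩ := hframe x (subset_closure hx)
    simpa using Fintype.card_le_of_injective σ hσ
  have hN : (0 : ℝ) < N := by exact_mod_cast (by omega : 0 < N)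
  set a : ℝ := (2 * N : ℝ)⁻¹ with ha
  have ha0 : 0 < a := by positivity
  have han : a * n - 1 ≤ 0 := by
    have h1 : (n : ℝ) ≤ N := by exact_mod_cast hnN
    have h2 : a * n ≤ a * (2 * N) := by gcongr; linarith
    have h3 : a * (2 * N) = 1 := by rw [ha]; field_simp
    linarith
  refine ⟨(a / 2) ^ n * M ^ (a * n - 1) * c ^ 3, by positivity, fun x hx => ?_⟩
  obtain ⟨σ, hσ, hσd, hσQ⟩ := hframe x (subset_closure hx)
  set q := ∏ i ∈ (Finset.univ.image σ)ᶜ, l i x with hq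
  set r := ∏ j, l (σ j) x with hr
  have hϖ : ∏ i, l i x = r * q := prod_eq_prod_frame_mul x hσ
  have hϖ0 := prod_pos_of_mem_polytope hx
  have hr0 : 0 < r := Finset.prod_pos fun j _ => hx (σ j)
  have hg := facetMean_pos hx
  set g := facetMean l x with hgdef
  set s := Real.sqrt (a * g / 2) with hs
  have hs2 : s ^ 2 = a * g / 2 := Real.sq_sqrt (by positivity)
  set B := diagonalMap (fun j => s * (l (σ j) x)⁻¹) ∘ₗ frameMap l σ with hB
  have hdet : LinearMap.det B ^ 2 =
      (a * g / 2) ^ n * (r⁻¹) ^ 2 * LinearMap.det (frameMap l σ) ^ 2 := by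
    rw [hB, LinearMap.det_comp, det_diagonalMap, Finset.prod_mul_distrib, Finset.prod_const,
      Finset.prod_inv_distrib, ← hr, Finset.card_univ, Fintype.card_fin, mul_pow, mul_pow,
      ← pow_mul, mul_comm n 2, pow_mul, hs2]
  have hd0 : 0 < LinearMap.det B ^ 2 := by
    rw [hdet]
    have : 0 < LinearMap.det (frameMap l σ) ^ 2 := hc.trans_le hσd
    positivity
  refine ⟨B, fun h => by simp [h] at hd0, fun ξ => ?_, ?_⟩
  · refine le_trans (le_of_eq ?_) (le_inner_facetMeanNegHessian hx hσ ξ)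
    rw [EuclideanSpace.real_norm_sq_eq, Finset.mul_sum]
    refine Finset.sum_congr rfl fun j _ => ?_
    rw [hB, LinearMap.comp_apply, diagonalMap_apply, frameMap_apply, ← ha, ← hgdef, ← hs2]
    ring
  · have hgn : M ^ (a * n - 1) * ∏ i, l i x ≤ g ^ n := by
      have h1 : g ^ n = (∏ i, l i x) ^ (a * n - 1) * ∏ i, l i x := by
        rw [hgdef, facetMean, ← ha, ← Real.rpow_natCast, ← Real.rpow_mul hϖ0.le,
          Real.rpow_sub_one hϖ0.ne', div_mul_cancel₀ _ hϖ0.ne']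
      rw [h1]
      exact mul_le_mul_of_nonneg_right (Real.rpow_le_rpow_of_nonpos hϖ0 (hM x hx).1 han) hϖ0.le
    have hrq : c / (∏ i, l i x) ≤ r⁻¹ := by
      rw [hϖ, div_le_iff₀ (hϖ ▸ hϖ0), inv_mul_cancel_left₀ hr0.ne']
      exact hσQ
    have hrq2 : (c / (∏ i, l i x)) ^ 2 ≤ r⁻¹ ^ 2 := by gcongr
    rw [hdet]
    calc (a / 2) ^ n * M ^ (a * n - 1) * c ^ 3 / ∏ i, l i x
        = (a / 2) ^ n * (M ^ (a * n - 1) * ∏ i, l i x) * (c / ∏ i, l i x) ^ 2 * c := by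
          field_simp
      _ ≤ (a / 2) ^ n * g ^ n * r⁻¹ ^ 2 * LinearMap.det (frameMap l σ) ^ 2 := by gcongr
      _ = _ := by rw [← mul_pow]; ring

/-- Positive definiteness of the Hessian makes the gradient strictly monotone along segments. -/
theorem IsSimplePolytope.injOn_facetMeanNegGradient (hn : 1 ≤ n) (hl : IsSimplePolytope l) :
    InjOn (facetMeanNegGradient l) (polytope l) := by
  obtain ⟨κ, -, hκ⟩ := hl.exists_hessian_lower_bound hn
  intro x hx y hy hxy
  by_contra hne
  set ξ := y - x with hξ
  have hξ0 : ξ ≠ 0 := sub_ne_zero.2 (Ne.symm hne)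
  have hmem : ∀ t ∈ Icc (0 : ℝ) 1, x + t • ξ ∈ polytope l := fun t ht => by
    have := convex_polytope hx hy (sub_nonneg.2 ht.2) ht.1 (by ring)
    convert this using 1
    rw [hξ]
    module
  have hder : ∀ t ∈ Icc (0 : ℝ) 1, HasDerivAt (fun t : ℝ => ⟪ξ, facetMeanNegGradient l (x + t • ξ)⟫)
      ⟪ξ, facetMeanNegHessian l (x + t • ξ) ξ⟫ t := fun t ht => by
    have h1 : HasDerivAt (fun t : ℝ => x + t • ξ) ξ t := by
      simpa using ((hasDerivAt_id t).smul_const ξ).const_add x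
    have h2 := (hasFDerivAt_facetMeanNegGradient (hmem t ht)).comp_hasDerivAt t h1
    exact (innerSL ℝ ξ).hasFDerivAt.comp_hasDerivAt t h2
  have hmono : StrictMonoOn (fun t : ℝ => ⟪ξ, facetMeanNegGradient l (x + t • ξ)⟫) (Icc 0 1) := by
    refine strictMonoOn_of_deriv_pos (convex_Icc 0 1)
      (fun t ht => (hder t ht).continuousAt.continuousWithinAt) fun t ht => ?_
    have ht' := interior_subset ht
    rw [(hder t ht').deriv, real_inner_comm]
    obtain ⟨B, hB, hBle, -⟩ := hκ _ (hmem t ht')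
    refine lt_of_lt_of_le ?_ (hBle ξ)
    have : B ξ ≠ 0 := fun h => hξ0 ((LinearMap.equivOfDetNeZero B hB).map_eq_zero_iff.1 h)
    positivity
  have hlt := hmono (left_mem_Icc.2 zero_le_one) (right_mem_Icc.2 zero_le_one) zero_lt_one
  simp only [zero_smul, add_zero, one_smul, hξ, add_sub_cancel] at hlt
  rw [hxy] at hlt
  exact lt_irrefl _ hlt

/-- The gradient map is injective and takes values in the subdifferentials, so the area formula
bounds the mass below by the integral of the Hessian determinant, at least `C ^ n * κ / ∏ l i`. The
affine term merely translates slopes. -/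
theorem IsSimplePolytope.exists_le_mongeAmpereMass (hn : 1 ≤ n) (hl : IsSimplePolytope l)
    (Λ : ℝ) :
    ∃ C > 0, ∀ (p : EuclideanSpace ℝ (Fin n)) (b : ℝ), ∀ G ⊆ polytope l, MeasurableSet G →
      ∫⁻ x in G, ENNReal.ofReal (Λ / ∏ i, l i x) ≤
        mongeAmpereMass (polytope l) (fun x => -(C * facetMean l x) + (⟪p, x⟫ - b)) G := by
  obtain ⟨κ, hκ0, hκ⟩ := hl.exists_hessian_lower_bound hn
  set C := max 1 (Λ / κ) with hC
  have hC1 : 1 ≤ C := le_max_left _ _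
  have hC0 : 0 < C := by linarith
  have hCΛ : Λ ≤ C ^ n * κ := by
    have h1 : Λ / κ ≤ C := le_max_right _ _
    rw [div_le_iff₀ hκ0] at h1
    refine h1.trans ?_
    gcongr
    exact le_self_pow₀ hC1 (by omega)
  refine ⟨C, hC0, fun p b G hG hGm => ?_⟩
  set f : EuclideanSpace ℝ (Fin n) → EuclideanSpace ℝ (Fin n) :=
    fun x => C • facetMeanNegGradient l x + p with hf
  have hfd : ∀ x ∈ G, HasFDerivWithinAt f (C • facetMeanNegHessian l x) G x := fun x hx =>
    (((hasFDerivAt_facetMeanNegGradient (hG hx)).const_smul C).add_const p).hasFDerivWithinAt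
  have hinj : InjOn f G := fun x hx y hy hxy =>
    hl.injOn_facetMeanNegGradient hn (hG hx) (hG hy)
      (smul_right_injective _ hC0.ne' (add_right_cancel hxy))
  calc ∫⁻ x in G, ENNReal.ofReal (Λ / ∏ i, l i x)
      ≤ ∫⁻ x in G, ENNReal.ofReal |(C • facetMeanNegHessian l x).det| := by
        refine setLIntegral_mono' hGm fun x hx => ENNReal.ofReal_le_ofReal ?_
        obtain ⟨B, hB, hBle, hBκ⟩ := hκ x (hG hx)
        have h1 := (isSymmetric_facetMeanNegHessian (l := l) (x := x)).sq_det_le_det hB hBle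
        have h2 : (C • facetMeanNegHessian l x).det = C ^ n *
            LinearMap.det (facetMeanNegHessian l x : EuclideanSpace ℝ (Fin n) →ₗ[ℝ] _) := by
          rw [ContinuousLinearMap.det, ContinuousLinearMap.toLinearMap_smul, LinearMap.det_smul,
            finrank_euclideanSpace_fin]
        rw [h2]
        refine le_trans ?_ (le_abs_self _)
        have hϖ0 := prod_pos_of_mem_polytope (hG hx)
        calc Λ / ∏ i, l i x ≤ C ^ n * κ / ∏ i, l i x := by gcongr
          _ = C ^ n * (κ / ∏ i, l i x) := mul_div_assoc _ _ _
          _ ≤ _ := by gcongr; exact hBκ.trans h1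
    _ = volume (f '' G) := lintegral_abs_det_fderiv_eq_addHaar_image volume hGm hfd hinj
    _ ≤ _ := by
        refine measure_mono ?_
        rintro _ ⟨x, hx, rfl⟩
        refine mem_iUnion₂.2 ⟨x, hx, fun y hy => ?_⟩
        have h1 := mul_le_mul_of_nonneg_left (facetMean_le (hG hx) (subset_closure hy)) hC0.le
        simp only [hf, facetMeanNegGradient, inner_add_left, smul_neg, inner_neg_left]
        rw [inner_smul_left (r := C), inner_sub_right p]
        simp only [conj_trivial]
        linarith

end Subsolution

/-! ### Integrability of negative powers of the product. -/

section Integrability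

variable {n N : ℕ} {l : Fin N → EuclideanSpace ℝ (Fin n) →ᵃ[ℝ] ℝ}

/-- In the affine coordinates `l (σ j)` the integral is dominated by a product of one-dimensional
integrals of `t ^ β` over `(0, M]`. -/
theorem lintegral_prod_frame_rpow_ne_top (hb : Bornology.IsBounded (polytope l)) {β : ℝ}
    (hβ : -1 < β) {σ : Fin n → Fin N} (hσ : LinearMap.det (frameMap l σ) ≠ 0) :
    ∫⁻ x in polytope l, ENNReal.ofReal (∏ j, l (σ j) x ^ β) ≠ ∞ := by
  obtain ⟨M, hM1, hM⟩ := exists_prod_le hb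
  set f : ℝ → ℝ := (Ioc 0 M).indicator fun t => t ^ β with hf
  have hfi : Integrable f := by
    rw [hf, integrable_indicator_iff measurableSet_Ioc,
      ← intervalIntegrable_iff_integrableOn_Ioc_of_le (by linarith)]
    exact intervalIntegral.intervalIntegrable_rpow' hβ
  have h1 : Integrable fun y : Fin n → ℝ => ∏ j, f (y j) := Integrable.fintype_prod fun _ => hfi
  have h2 : Integrable fun y : EuclideanSpace ℝ (Fin n) => ∏ j, f (y j) :=
    (PiLp.volume_preserving_ofLp (Fin n)).integrable_comp_of_integrable h1
  set b₀ : EuclideanSpace ℝ (Fin n) := WithLp.toLp 2 fun j => l (σ j) 0 with hb₀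
  have h3 : Integrable fun y : EuclideanSpace ℝ (Fin n) => ∏ j, f ((y + b₀) j) :=
    h2.comp_add_right b₀
  have h4 : Integrable fun x : EuclideanSpace ℝ (Fin n) => ∏ j, f ((frameMap l σ x + b₀) j) := by
    have hm : Measurable (frameMap l σ) :=
      (frameMap l σ).continuous_of_finiteDimensional.measurable
    refine Integrable.comp_measurable (g := fun y : EuclideanSpace ℝ (Fin n) =>
      ∏ j, f ((y + b₀) j)) ?_ hm
    rw [Measure.map_linearMap_addHaar_eq_smul_addHaar _ hσ]
    exact h3.smul_measure ENNReal.ofReal_ne_top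
  refine ((setLIntegral_mono' isOpen_polytope.measurableSet fun x hx => ?_).trans_lt
    ((setLIntegral_le_lintegral _ _).trans_lt h4.lintegral_lt_top)).ne
  refine ENNReal.ofReal_le_ofReal (le_of_eq (Finset.prod_congr rfl fun j _ => ?_))
  have hval : (frameMap l σ x + b₀) j = l (σ j) x := by
    have := affine_eq_add_inner (l (σ j)) 0 x
    rw [sub_zero, inner_affineGradient] at this
    rw [PiLp.add_apply, frameMap_apply, hb₀, this, add_comm]
  have hmem : l (σ j) x ∈ Ioc 0 M := ⟨hx _, (hM x hx).2 _⟩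
  rw [hval, hf, indicator_of_mem hmem]

theorem IsSimplePolytope.lintegral_prod_rpow_ne_top (hl : IsSimplePolytope l) {β : ℝ}
    (hβ : -1 < β) (hβ0 : β ≤ 0) :
    ∫⁻ x in polytope l, ENNReal.ofReal ((∏ i, l i x) ^ β) ≠ ∞ := by
  classical
  obtain ⟨c, hc, hframe⟩ := hl.exists_uniform_frame
  set T : Finset (Fin n → Fin N) := Finset.univ.filter fun σ => LinearMap.det (frameMap l σ) ≠ 0
  have hm : ∀ σ : Fin n → Fin N, Measurable fun x => ENNReal.ofReal (∏ j, l (σ j) x ^ β) :=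
    fun σ => (Finset.measurable_fun_prod _ fun j _ =>
      (continuous_affine (l (σ j))).measurable.pow_const β).ennreal_ofReal
  -- Summing over all nondegenerate frames avoids a measurable choice of a frame at each point.
  have hle : ∫⁻ x in polytope l, ENNReal.ofReal ((∏ i, l i x) ^ β) ≤
      ∫⁻ x in polytope l, ENNReal.ofReal (c ^ β) *
        ∑ σ ∈ T, ENNReal.ofReal (∏ j, l (σ j) x ^ β) := by
    refine setLIntegral_mono' isOpen_polytope.measurableSet fun x hx => ?_
    obtain ⟨σ, hσ, hσd, hσQ⟩ := hframe x (subset_closure hx)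
    have hσT : σ ∈ T := by
      simp only [T, Finset.mem_filter, Finset.mem_univ, true_and]
      intro h0
      rw [h0] at hσd
      simp at hσd
      linarith
    have hr0 : 0 ≤ ∏ j, l (σ j) x := Finset.prod_nonneg fun j _ => (hx _).le
    calc ENNReal.ofReal ((∏ i, l i x) ^ β)
        ≤ ENNReal.ofReal (c ^ β * ∏ j, l (σ j) x ^ β) := by
          refine ENNReal.ofReal_le_ofReal ?_
          rw [prod_eq_prod_frame_mul x hσ, Real.mul_rpow hr0 (hc.le.trans hσQ), mul_comm,
            Real.finsetProd_rpow _ _ fun j _ => (hx (σ j)).le]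
          exact mul_le_mul_of_nonneg_right (Real.rpow_le_rpow_of_nonpos hc hσQ hβ0)
            (Real.rpow_nonneg hr0 _)
      _ = ENNReal.ofReal (c ^ β) * ENNReal.ofReal (∏ j, l (σ j) x ^ β) :=
          ENNReal.ofReal_mul (by positivity)
      _ ≤ _ := by
          gcongr
          exact Finset.single_le_sum (f := fun σ : Fin n → Fin N =>
            ENNReal.ofReal (∏ j, l (σ j) x ^ β)) (fun _ _ => zero_le) hσT
  refine (hle.trans_lt ?_).ne
  rw [lintegral_const_mul _ (Finset.measurable_fun_sum _ fun σ _ => hm σ),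
    lintegral_finsetSum _ fun σ _ => hm σ]
  refine ENNReal.mul_lt_top ENNReal.ofReal_lt_top (ENNReal.sum_lt_top.2 fun σ hσ => ?_)
  exact (lintegral_prod_frame_rpow_ne_top hl.bounded hβ (Finset.mem_filter.1 hσ).2).lt_top

end Integrability

/-! ### The right hand side as a measure. -/

section PolytopeMeasure

variable {n N : ℕ} {l : Fin N → EuclideanSpace ℝ (Fin n) →ᵃ[ℝ] ℝ}
  {h : EuclideanSpace ℝ (Fin n) → ℝ} {Λ : ℝ}

/-- The right hand side of the Monge–Ampère equation as a measure. -/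
noncomputable def polytopeMeasure (l : Fin N → EuclideanSpace ℝ (Fin n) →ᵃ[ℝ] ℝ)
    (h : EuclideanSpace ℝ (Fin n) → ℝ) : Measure (EuclideanSpace ℝ (Fin n)) :=
  (volume.restrict (polytope l)).withDensity fun x => ENNReal.ofReal (h x / ∏ i, l i x)

theorem polytopeMeasure_apply {A : Set (EuclideanSpace ℝ (Fin n))} (hA : A ⊆ polytope l)
    (hAm : MeasurableSet A) :
    polytopeMeasure l h A = ∫⁻ x in A, ENNReal.ofReal (h x / ∏ i, l i x) := by
  rw [polytopeMeasure, withDensity_apply _ hAm, Measure.restrict_restrict hAm,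
    inter_eq_self_of_subset_left hA]

theorem polytopeMeasure_ne_top (h_bound : ∀ x ∈ polytope l, h x ≤ Λ)
    {S : Set (EuclideanSpace ℝ (Fin n))} (hS : S ⊆ polytope l) (hSc : IsCompact S) :
    polytopeMeasure l h S ≠ ∞ := by
  rw [polytopeMeasure_apply hS hSc.measurableSet]
  rcases S.eq_empty_or_nonempty with rfl | hne
  · simp
  obtain ⟨y, hy, hmin⟩ := hSc.exists_isMinOn hne
    (continuous_finsetProd Finset.univ fun i _ => continuous_affine (l i)).continuousOn
  refine ((setLIntegral_mono' hSc.measurableSet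
    (g := fun _ => ENNReal.ofReal (|Λ| / ∏ i, l i y)) fun x hx => ?_).trans_lt ?_).ne
  · have h1 : ∏ i, l i y ≤ ∏ i, l i x := hmin hx
    have h2 := prod_pos_of_mem_polytope (hS hy)
    have h3 := prod_pos_of_mem_polytope (hS hx)
    refine ENNReal.ofReal_le_ofReal ?_
    calc h x / ∏ i, l i x ≤ |Λ| / ∏ i, l i x := by
          gcongr; exact (h_bound x (hS hx)).trans (le_abs_self _)
      _ ≤ |Λ| / ∏ i, l i y := by gcongr
  · rw [setLIntegral_const]
    exact ENNReal.mul_lt_top ENNReal.ofReal_lt_top hSc.measure_lt_top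

theorem polytopeMeasure_ne_zero (hb : Bornology.IsBounded (polytope l)) {c : ℝ} (hc : 0 < c)
    (h_bound : ∀ x ∈ polytope l, c ≤ h x) {G : Set (EuclideanSpace ℝ (Fin n))}
    (hG : G ⊆ polytope l) (hGo : IsOpen G) (hne : G.Nonempty) : polytopeMeasure l h G ≠ 0 := by
  rw [polytopeMeasure_apply hG hGo.measurableSet]
  obtain ⟨M, hM1, hM⟩ := exists_prod_le hb
  have hpos : 0 < ENNReal.ofReal (c / M) * volume G :=
    ENNReal.mul_pos (by simpa using by positivity) (hGo.measure_pos volume hne).ne'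
  refine (hpos.trans_le ?_).ne'
  rw [← setLIntegral_const]
  refine setLIntegral_mono' hGo.measurableSet fun x hx => ENNReal.ofReal_le_ofReal ?_
  have h3 := prod_pos_of_mem_polytope (hG hx)
  calc c / M ≤ c / ∏ i, l i x := by gcongr; exact (hM x (hG hx)).1
    _ ≤ h x / ∏ i, l i x := by gcongr; exact h_bound x (hG hx)

theorem lintegral_facetMean_polytopeMeasure_ne_top (hl : IsSimplePolytope l) (hN : 0 < N)
    (h_meas : AEMeasurable h (volume.restrict (polytope l)))
    (h_bound : ∀ x ∈ polytope l, h x ≤ Λ) {C : ℝ} (hC : 0 ≤ C) :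
    ∫⁻ x in polytope l, ENNReal.ofReal (C * facetMean l x) ∂polytopeMeasure l h ≠ ∞ := by
  have hN' : (1 : ℝ) ≤ N := by exact_mod_cast hN
  have hcont : Continuous fun x => ∏ i, l i x :=
    continuous_finsetProd Finset.univ fun i _ => continuous_affine (l i)
  have hfm : AEMeasurable (fun x => ENNReal.ofReal (h x / ∏ i, l i x))
      (volume.restrict (polytope l)) :=
    (h_meas.div hcont.measurable.aemeasurable).ennreal_ofReal
  have hgm : AEMeasurable (fun x => ENNReal.ofReal (C * facetMean l x))
      (volume.restrict (polytope l)) :=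
    (continuous_facetMean.const_mul C).measurable.ennreal_ofReal.aemeasurable
  -- The barrier times the density is comparable to this power of the product, and `β > -1`.
  set β : ℝ := (2 * N : ℝ)⁻¹ - 1 with hβ
  have hinv : (2 * N : ℝ)⁻¹ ≤ 1 := inv_le_one_of_one_le₀ (by linarith)
  have hinv0 : 0 < (2 * N : ℝ)⁻¹ := by positivity
  refine ((setLIntegral_le_lintegral _ _).trans_lt ?_).ne
  rw [polytopeMeasure, lintegral_withDensity_eq_lintegral_mul₀ hfm hgm]
  refine (setLIntegral_mono' isOpen_polytope.measurableSet
    (g := fun x => ENNReal.ofReal (|Λ| * C) * ENNReal.ofReal ((∏ i, l i x) ^ β))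
    fun x hx => ?_).trans_lt ?_
  · have h3 := prod_pos_of_mem_polytope hx
    have hg := facetMean_pos hx
    rw [Pi.mul_apply, ← ENNReal.ofReal_mul' (by positivity), ← ENNReal.ofReal_mul (by positivity)]
    refine ENNReal.ofReal_le_ofReal ?_
    have h4 : (∏ i, l i x) ^ β = facetMean l x / ∏ i, l i x := by
      rw [hβ, Real.rpow_sub_one h3.ne', facetMean]
    rw [h4]
    calc h x / (∏ i, l i x) * (C * facetMean l x)
        ≤ |Λ| / (∏ i, l i x) * (C * facetMean l x) := by
          gcongr; exact (h_bound x hx).trans (le_abs_self _)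
      _ = |Λ| * C * (facetMean l x / ∏ i, l i x) := by ring
  · rw [lintegral_const_mul' _ _ ENNReal.ofReal_ne_top]
    exact ENNReal.mul_lt_top ENNReal.ofReal_lt_top
      (hl.lintegral_prod_rpow_ne_top (by linarith) (by linarith)).lt_top

end PolytopeMeasure

/-! ### The Dirichlet problem on the polytope. -/

theorem theorem2p1 {n N : ℕ} (hn : 1 ≤ n)
    (l : Fin N → EuclideanSpace ℝ (Fin n) →ᵃ[ℝ] ℝ) (hl : IsSimplePolytope l)
    (φ h : EuclideanSpace ℝ (Fin n) → ℝ)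
    (hφ : ContDiffOn ℝ 2 (fun x => φ x - ∑ i, l i x * Real.log (l i x)) (closure (polytope l)))
    (hφ_convex : ∀ i, ConvexOn ℝ (polytopeFacet l i) φ)
    (Λ : ℝ) (hΛ : 1 < Λ)
    (h_meas : AEMeasurable h (volume.restrict (polytope l)))
    (h_bound : ∀ x ∈ polytope l, 1 / Λ ≤ h x ∧ h x ≤ Λ) :
    ∃ u : EuclideanSpace ℝ (Fin n) → ℝ, SolvesDirichlet l h φ u ∧
      ∀ w : EuclideanSpace ℝ (Fin n) → ℝ, SolvesDirichlet l h φ w →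
        Set.EqOn w u (closure (polytope l)) := by
  have := nontrivial_euclideanSpace hn
  have hφc : ContinuousOn φ (closure (polytope l)) := by
    -- The convention `Real.log 0 = 0` makes `t * log t` continuous up to the facets.
    have h1 : Continuous fun x => ∑ i, l i x * Real.log (l i x) :=
      continuous_finsetSum _ fun i _ => Real.continuous_mul_log.comp (continuous_affine (l i))
    exact (hφ.continuousOn.add h1.continuousOn).congr fun x _ => by simp
  have hN : 0 < N := by
    obtain ⟨x, hx⟩ := frontier_nonempty_of_isBounded hl.bounded hl.nonempty
    exact (exists_eq_zero_of_mem_frontier hx).choose.pos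
  have hμK := fun S (hS : S ⊆ polytope l) (hSc : IsCompact S) =>
    polytopeMeasure_ne_top (fun x hx => (h_bound x hx).2) hS hSc
  have hμpos := fun G (hG : G ⊆ polytope l) (hGo : IsOpen G) (hne : G.Nonempty) =>
    polytopeMeasure_ne_zero hl.bounded (by positivity) (fun x hx => (h_bound x hx).1) hG hGo hne
  obtain ⟨C, hC, hbarrier⟩ := hl.exists_le_mongeAmpereMass hn Λ
  obtain ⟨u, hucv, huc, huφ, humass⟩ := exists_mongeAmpereMass_eq hn isOpen_polytope
    convex_polytope hl.bounded hl.nonempty hμK hμpos (v := fun x => -(C * facetMean l x))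
    (φ := φ) (continuous_facetMean.const_mul C).neg.continuousOn
    (concaveOn_facetMean.smul hC.le).neg
    (fun x hx => by
      obtain ⟨i, hi⟩ := exists_eq_zero_of_mem_frontier hx
      rw [facetMean_eq_zero hi, mul_zero, neg_zero])
    (fun x hx => neg_neg_of_pos (mul_pos hC (facetMean_pos hx)))
    (by
      simp only [neg_neg]
      exact lintegral_facetMean_polytopeMeasure_ne_top hl hN h_meas
        (fun x hx => (h_bound x hx).2) hC.le)
    (fun p b G hGo hG => by
      have hG' := subset_closure.trans hG
      rw [polytopeMeasure_apply hG' hGo.measurableSet]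
      refine le_trans (setLIntegral_mono' hGo.measurableSet fun x hx =>
        ENNReal.ofReal_le_ofReal ?_) (hbarrier p b G hG' hGo.measurableSet)
      have := prod_pos_of_mem_polytope (hG' hx)
      gcongr
      exact (h_bound x (hG' hx)).2)
    (hφc.mono frontier_subset_closure)
    (isAffinelySupported_frontier_polytope hl.bounded hφc hφ_convex)
  refine ⟨u, ⟨hucv, huc, ⟨hucv.subset subset_closure convex_polytope, fun A hA hAm => ?_⟩, huφ⟩,
    fun w hw => ?_⟩
  · rw [humass A hA hAm, polytopeMeasure_apply hA hAm]
  · refine eqOn_of_mongeAmpereMass_eq hn isOpen_polytope hl.bounded hμK hμpos huc hw.continuous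
      (fun x hx => by rw [hw.boundary x hx, huφ x hx]) humass fun A hA hAm => ?_
    rw [hw.equation.2 A hA hAm, polytopeMeasure_apply hA hAm]
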